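/- \textbf{Proposition (Generalized gyration).} Let $\Lambda$ be a finite region of the square lattice $\mathbb{Z}^2$ enclosed by a simple closed path of length $2N>0$ on the dual lattice, run counter-clockwise from a chosen starting point. The edges of $\Lambda$ are the lattice edges with at least one endpoint in the region. The $2N$ boundary edges (\emph{terminations}), i.e. the edges crossed by the path, are numbered $1,\dots,2N$ in the order in which the path crosses them. For $\tau\in\{b,w\}^{2N}$ let $\mathrm{Fpl}(\Lambda,\tau)$ be the set of colourings of the edges of $\Lambda$ in black and white such that every vertex of the region is adjacent to two black and two white edges and the $k$-th termination has colour $\tau_k$; let $\bar\tau$ be the complementary boundary condition. Let $\mathrm{LP}(m)$ be the set of non-crossing perfect matchings (link patterns) of $2m$ cyclically labelled points on the border of a disk. If $\tau$ has $2m$ black terminations, labelled $1,\dots,2m$ in the above order, every $\phi\in\mathrm{Fpl}(\Lambda,\tau)$ has a link pattern $\pi(\phi)\in\mathrm{LP}(m)$, pairing the labels that are connected by open black paths, and $\Psi_{\Lambda,\tau}(\pi)$ denotes the number of $\phi\in\mathrm{Fpl}(\Lambda,\tau)$ with $\pi(\phi)=\pi$. For $1\le j\le 2m-1$ let $c_j:\mathbb{C}^{\mathrm{LP}(m)}\to\mathbb{C}^{\mathrm{LP}(m-1)}$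 be the linear operator that joins the points $j$ and $j+1$ to each other and removes them (together with the cycle that arises if $j$ and $j+1$ were matched, with weight $1$), the other points being relabelled in order. Glue together the outer ends of the terminations $2i-1$ and $2i$ into one vertex of degree two, for every $1\le i\le N$, and call $\mathcal{G}$ the resulting graph. Let $\Gamma$ be the partition of its edges into the cycles formed by the edges of $\Lambda$ around the elementary plaquettes of the same parity as those lying between the terminations $2i-1$ and $2i$. Let $V''(\tau)$ be the set of the glued vertices with one black and one white termination. Assume that the triplet $(\mathcal{G},\tau,\Gamma)$ is valid: all the cycles in $\Gamma$ have length at most $4$, and all those adjacent to a vertex of $V''(\tau)$ have length at most $3$. Let $N_{bb},N_{ww},N_{bw},N_{wb}$ be the numbers of pairs $(2i-1,2i)$ with colours $(b,b)$, $(w,w)$, $(b,w)$, $(w,b)$ in $\tau$, and suppose that $N_{bw}+N_{wb}=2n$ is even (otherwise $\mathrm{Fpl}(\Lambda,\tau)$ and $\mathrm{Fpl}(\Lambda,\bar\tau)$ are empty). Put $m_1=n+N_{bb}$ and $m_2=n+N_{ww}$, so that $\tau$ and $\bar\tau$ have $2m_1$ and $2m_2$ black terminations respectively, and let $$|s_1\rangle=\sum_{\pi\in\mathrm{LP}(m_1)}\Psi_{\Lambda,\tau}(\pi)\,|\pi\rangle,\qquad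 |s_2\rangle=\sum_{\pi\in\mathrm{LP}(m_2)}\Psi_{\Lambda,\bar\tau}(\pi)\,|\pi\rangle .$$ Let $J_1\subset\{1,\dots,2m_1-1\}$ be the set of the labels, among the black terminations of $\tau$, of the first termination of each pair coloured $(b,b)$ in $\tau$, and let $J_2\subset\{1,\dots,2m_2-1\}$ be the analogous set for $\bar\tau$ (that is, for the pairs coloured $(w,w)$ in $\tau$). Then, in $\mathbb{C}^{\mathrm{LP}(n)}$, $$\Big(\prod_{j\in J_1}c_j\Big)|s_1\rangle=\Big(\prod_{j\in J_2}c_j\Big)|s_2\rangle ,$$ where both products are written in increasing order of $j$ from left to right (the factor with the highest index acts first). -/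

import Mathlib

/-! ### Link patterns and the closing operators

Points are labelled from `0`: the `2 n` points on the border of the disk are
`0, 1, …, 2 n - 1`, in cyclic order. -/

/-- A link pattern in `LP(n)`: a non-crossing perfect matching of `2 n` points on the border of a
disk, given by the fixed-point-free involution that sends every point to its partner. -/
@[ext]
structure LinkPattern (n : ℕ) where
  partner : Fin (2 * n) → Fin (2 * n)
  partner_partner : ∀ i, partner (partner i) = i
  partner_ne : ∀ i, partner i ≠ i
  noncrossing : ∀ i k, ¬ (i < k ∧ k < partner i ∧ partner i < partner k)

namespace LinkPattern

noncomputable instance (n : ℕ) : Fintype (LinkPattern n) :=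
  Fintype.ofInjective LinkPattern.partner fun _ _ h => LinkPattern.ext h

/-- The increasing relabelling of the points other than `j`, `j + 1`. -/
def skip {n : ℕ} (j : ℕ) (i : Fin (2 * n)) : Fin (2 * (n + 1)) :=
  if i.val < j then ⟨i.val, by omega⟩ else ⟨i.val + 2, by omega⟩

/-- The partner of a point `x` (other than `a`, `b`) once the points `a` and `b` have been joined
to each other by an external arc. -/
def joined {n : ℕ} (π : LinkPattern n) (a b x : Fin (2 * n)) : Fin (2 * n) :=
  if π.partner x = a then π.partner b
  else if π.partner x = b then π.partner a
  else π.partner x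

theorem skip_ne {n j : ℕ} (i : Fin (2 * n)) :
    (skip j i).val ≠ j ∧ (skip j i).val ≠ j + 1 := by
  unfold skip; split <;> simp <;> omega

theorem exists_skip {n j : ℕ} (h : j + 1 < 2 * (n + 1)) (x : Fin (2 * (n + 1)))
    (h0 : x.val ≠ j) (h1 : x.val ≠ j + 1) : ∃ i : Fin (2 * n), skip j i = x := by
  rcases Nat.lt_or_ge x.val j with hx | hx
  · exact ⟨⟨x.val, by omega⟩, by simp [skip, hx]⟩
  · refine ⟨⟨x.val - 2, by omega⟩, ?_⟩
    have : ¬ (x.val - 2 < j) := by omega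
    ext; simp [skip, this]; omega

theorem skip_lt_iff {n j : ℕ} (i k : Fin (2 * n)) : skip j i < skip j k ↔ i < k := by
  simp only [skip, Fin.lt_def]; split <;> split <;> simp <;> omega

theorem skip_injective {n j : ℕ} : Function.Injective (skip (n := n) j) := by
  intro i k h
  rcases lt_trichotomy i k with h1 | h1 | h1
  · exact absurd h ((skip_lt_iff (j := j) i k).2 h1).ne
  · exact h1
  · exact absurd h ((skip_lt_iff (j := j) k i).2 h1).ne'

theorem joined_ne {n : ℕ} (π : LinkPattern n) {a b x : Fin (2 * n)}
    (hxa : x ≠ a) (hxb : x ≠ b) : π.joined a b x ≠ a ∧ π.joined a b x ≠ b := by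
  have hx := π.partner_partner x
  have ha := π.partner_partner a
  have hb := π.partner_partner b
  have na := π.partner_ne a
  have nb := π.partner_ne b
  unfold joined
  split_ifs <;> constructor <;> intro h <;> simp_all

theorem joined_joined {n : ℕ} (π : LinkPattern n) {a b x : Fin (2 * n)}
    (hxa : x ≠ a) (hxb : x ≠ b) : π.joined a b (π.joined a b x) = x := by
  have hx := π.partner_partner x
  have ha := π.partner_partner a
  have hb := π.partner_partner b
  unfold joined
  split_ifs <;> simp_all

theorem joined_self_ne {n : ℕ} (π : LinkPattern n) {a b x : Fin (2 * n)} (hab : a ≠ b) :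
    π.joined a b x ≠ x := by
  have hx := π.partner_partner x
  have ha := π.partner_partner a
  have hb := π.partner_partner b
  have nx := π.partner_ne x
  unfold joined
  split_ifs <;> intro h <;> simp_all

theorem joined_noncrossing {n : ℕ} (π : LinkPattern n) {a b x y : Fin (2 * n)}
    (hab : b.val = a.val + 1) (hxa : x ≠ a) (hxb : x ≠ b) (hya : y ≠ a) (hyb : y ≠ b) :
    ¬ (x < y ∧ y < π.joined a b x ∧ π.joined a b x < π.joined a b y) := by
  have hx := π.partner_partner x
  have hy := π.partner_partner y
  have ha := π.partner_partner a
  have hb := π.partner_partner b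
  have nc := π.noncrossing
  simp only [Fin.lt_def] at nc ⊢
  simp only [ne_eq, Fin.ext_iff] at hxa hxb hya hyb
  unfold joined
  split_ifs with h1 h2 h3 h4 h5 h6
  all_goals
    have a1 := nc x y
    have a2 := nc x a
    have a3 := nc x b
    have a4 := nc y a
    have a5 := nc y b
    have a6 := nc a y
    have a7 := nc b y
    have a8 := nc x (π.partner a)
    have a9 := nc x (π.partner b)
    have b1 := nc y (π.partner a)
    have b2 := nc y (π.partner b)
    have b3 := nc (π.partner a) y
    have b4 := nc (π.partner b) y
    have b5 := nc (π.partner a) x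
    have b6 := nc (π.partner b) x
    have b7 := nc a x
    have b8 := nc b x
    simp_all
  all_goals grind

/-- The arc-closing operation `c_j : LP(n+1) → LP(n)` on link patterns: the points `j` and `j + 1`
are joined to each other and removed (together with the cycle that arises if they were partners),
and the other points keep their order. -/
noncomputable def close {n : ℕ} (j : ℕ) (h : j + 1 < 2 * (n + 1)) (π : LinkPattern (n + 1)) :
    LinkPattern n :=
  let a : Fin (2 * (n + 1)) := ⟨j, by omega⟩
  let b : Fin (2 * (n + 1)) := ⟨j + 1, h⟩
  have hs : ∀ i : Fin (2 * n), skip j i ≠ a ∧ skip j i ≠ b := fun i => by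
    simpa [a, b, Fin.ext_iff] using skip_ne (j := j) i
  have hex : ∀ i : Fin (2 * n), ∃ k : Fin (2 * n), skip j k = π.joined a b (skip j i) := fun i => by
    have hj := π.joined_ne (hs i).1 (hs i).2
    refine exists_skip h _ ?_ ?_
    · simpa [a, Fin.ext_iff] using hj.1
    · simpa [b, Fin.ext_iff] using hj.2
  { partner := fun i => (hex i).choose
    partner_partner := fun i => skip_injective (j := j) (by
      rw [(hex _).choose_spec, (hex i).choose_spec]
      exact π.joined_joined (hs i).1 (hs i).2)
    partner_ne := fun i hi => by
      have h1 := (hex i).choose_spec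
      rw [hi] at h1
      exact π.joined_self_ne (by simp [a, b, Fin.ext_iff]) h1.symm
    noncrossing := fun i k hik => by
      rw [← skip_lt_iff (j := j) i, ← skip_lt_iff (j := j) k, ← skip_lt_iff (j := j) _ (hex k).choose,
        (hex i).choose_spec, (hex k).choose_spec] at hik
      exact π.joined_noncrossing rfl (hs i).1 (hs i).2 (hs k).1 (hs k).2 hik }

/-- The defining property of `close`. -/
theorem skip_close_partner {n : ℕ} (j : ℕ) (h : j + 1 < 2 * (n + 1)) (π : LinkPattern (n + 1))
    (i : Fin (2 * n)) :
    skip j ((close j h π).partner i) = π.joined ⟨j, by omega⟩ ⟨j + 1, h⟩ (skip j i) := by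
  unfold close
  exact Exists.choose_spec (p := fun k => skip j k = _) _

end LinkPattern

/-- The space `ℂ^{LP(n)}`; the basis vector `|π⟩` is `Finsupp.single π 1`. -/
abbrev LPSpace (n : ℕ) : Type := LinkPattern n →₀ ℂ

open Classical in
/-- The linear operator `c_j`, `c_j |π⟩ = |c_j π⟩`, defined for `j + 1 < 2 (n + 1)`
(and set to `0` for the other `j`, that are never used). -/
noncomputable def closeOp (n j : ℕ) : LPSpace (n + 1) →ₗ[ℂ] LPSpace n :=
  if h : j + 1 < 2 * (n + 1) then Finsupp.lmapDomain ℂ ℂ (LinkPattern.close j h) else 0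

/-- For a list `[j₁, j₂, …, j_r]` the operator `c_{j_r} ⋯ c_{j₂} c_{j₁}`: the head of the list acts
first. -/
noncomputable def closeList (n : ℕ) : (L : List ℕ) → (LPSpace (n + L.length) →ₗ[ℂ] LPSpace n)
  | [] => LinearMap.id
  | j :: L => (closeList n L).comp (closeOp (n + L.length) j)

/-- The product of the `c_j`, `j ∈ J`, written in increasing order from left to right: the highest
index acts first. -/
noncomputable def closeProd (n : ℕ) (J : Finset ℕ) :
    LPSpace (n + (J.sort (· ≥ ·)).length) →ₗ[ℂ] LPSpace n :=
  closeList n (J.sort (· ≥ ·))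

/-! ### Boundary conditions

A boundary condition on `2 N` terminations, listed in cyclic order from a fixed starting point, is a
map `τ : Fin (2 * N) → Bool`, where `true` stands for black and `false` for white. -/

/-- The complementary boundary condition. -/
def complBC {N : ℕ} (τ : Fin (2 * N) → Bool) : Fin (2 * N) → Bool := fun k => !τ k

/-- The first termination of the `i`-th pair of consecutive terminations. -/
def fstTerm {N : ℕ} (i : Fin N) : Fin (2 * N) := ⟨2 * i.val, by omega⟩

/-- The second termination of the `i`-th pair of consecutive terminations. -/
def sndTerm {N : ℕ} (i : Fin N) : Fin (2 * N) := ⟨2 * i.val + 1, by omega⟩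

/-- The black terminations. -/
def blackTerms {N : ℕ} (τ : Fin (2 * N) → Bool) : Finset (Fin (2 * N)) :=
  Finset.univ.filter fun k => τ k = true

/-- The pairs coloured (black, black). -/
def bbPairs {N : ℕ} (τ : Fin (2 * N) → Bool) : Finset (Fin N) :=
  Finset.univ.filter fun i => τ (fstTerm i) = true ∧ τ (sndTerm i) = true

/-- The pairs coloured (black, white) or (white, black). -/
def mixedPairs {N : ℕ} (τ : Fin (2 * N) → Bool) : Finset (Fin N) :=
  Finset.univ.filter fun i => τ (fstTerm i) ≠ τ (sndTerm i)

/-- The label of a black termination in the cyclic labelling of the black terminations. -/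
def blackLabel {N : ℕ} (τ : Fin (2 * N) → Bool) (k : Fin (2 * N)) : ℕ :=
  ((blackTerms τ).filter fun l => l < k).card

/-- The set of the labels, among the black terminations, of the first termination of each
(black, black) pair. -/
def bbIndices {N : ℕ} (τ : Fin (2 * N) → Bool) : Finset ℕ :=
  (bbPairs τ).image fun i => blackLabel τ (fstTerm i)

theorem blackLabel_lt {N : ℕ} (τ : Fin (2 * N) → Bool) {k l : Fin (2 * N)} (hk : τ k = true)
    (h : k < l) : blackLabel τ k < blackLabel τ l := by
  refine Finset.card_lt_card (Finset.ssubset_iff.2 ⟨k, by simp, ?_⟩)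
  intro x hx
  simp only [Finset.mem_insert, Finset.mem_filter, blackTerms, Finset.mem_univ, true_and] at hx ⊢
  rcases hx with rfl | hx
  · exact ⟨hk, h⟩
  · exact ⟨hx.1, hx.2.trans h⟩

theorem card_bbIndices {N : ℕ} (τ : Fin (2 * N) → Bool) :
    (bbIndices τ).card = (bbPairs τ).card := by
  refine Finset.card_image_of_injOn ?_
  intro i hi k hk h
  simp only [bbPairs, Finset.coe_filter, Finset.mem_univ, true_and, Set.mem_ofPred_eq] at hi hk
  rcases lt_trichotomy i k with h1 | h1 | h1
  · have := blackLabel_lt τ hi.1 (l := fstTerm k) (by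
      rw [Fin.lt_def] at h1 ⊢; simp only [fstTerm]; omega)
    simp_all
  · exact h1
  · have := blackLabel_lt τ hk.1 (l := fstTerm i) (by
      rw [Fin.lt_def] at h1 ⊢; simp only [fstTerm]; omega)
    simp_all

theorem card_blackTerms {N : ℕ} (τ : Fin (2 * N) → Bool) :
    (blackTerms τ).card = 2 * (bbPairs τ).card + (mixedPairs τ).card := by
  have hf : Function.Injective (fstTerm (N := N)) := fun i k h => by
    simp [fstTerm, Fin.ext_iff] at *; omega
  have hs : Function.Injective (sndTerm (N := N)) := fun i k h => by
    simp [sndTerm, Fin.ext_iff] at *; omega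
  have h1 : blackTerms τ =
      ((Finset.univ.filter fun i => τ (fstTerm i) = true).image fstTerm) ∪
      ((Finset.univ.filter fun i => τ (sndTerm i) = true).image sndTerm) := by
    ext k
    simp only [blackTerms, Finset.mem_filter, Finset.mem_univ, true_and, Finset.mem_union,
      Finset.mem_image]
    constructor
    · intro hk
      rcases Nat.even_or_odd' k.val with ⟨c, hc | hc⟩
      · have : fstTerm ⟨c, by omega⟩ = k := by simp [fstTerm, Fin.ext_iff, hc]
        exact Or.inl ⟨⟨c, by omega⟩, by rw [this]; exact hk, this⟩
      · have : sndTerm ⟨c, by omega⟩ = k := by simp [sndTerm, Fin.ext_iff, hc]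
        exact Or.inr ⟨⟨c, by omega⟩, by rw [this]; exact hk, this⟩
    · rintro (⟨i, hi, rfl⟩ | ⟨i, hi, rfl⟩) <;> exact hi
  have hd : Disjoint ((Finset.univ.filter fun i => τ (fstTerm i) = true).image (fstTerm (N := N)))
      ((Finset.univ.filter fun i => τ (sndTerm i) = true).image sndTerm) := by
    rw [Finset.disjoint_left]
    intro k hk hk'
    simp only [Finset.mem_image] at hk hk'
    obtain ⟨i, -, rfl⟩ := hk
    obtain ⟨l, -, h⟩ := hk'
    simp [fstTerm, sndTerm, Fin.ext_iff] at h
    omega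
  rw [h1, Finset.card_union_of_disjoint hd, Finset.card_image_of_injective _ hf,
    Finset.card_image_of_injective _ hs]
  simp only [bbPairs, mixedPairs, Finset.card_filter, Finset.mul_sum, ← Finset.sum_add_distrib]
  refine Finset.sum_congr rfl fun i _ => ?_
  cases τ (fstTerm i) <;> cases τ (sndTerm i) <;> simp

theorem mixedPairs_complBC {N : ℕ} (τ : Fin (2 * N) → Bool) :
    mixedPairs (complBC τ) = mixedPairs τ := by
  ext i; simp [mixedPairs, complBC]

/-- If there are `2 n` mixed pairs, then there are `2 m` black terminations, where `m` is the sum of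
`n` and of the number of (black, black) pairs. -/
theorem card_blackTerms_eq {N n : ℕ} (τ : Fin (2 * N) → Bool) (hn : (mixedPairs τ).card = 2 * n) :
    (blackTerms τ).card = 2 * (n + ((bbIndices τ).sort (· ≥ ·)).length) := by
  rw [card_blackTerms, Finset.length_sort, card_bbIndices, hn]; ring

/-! ### The square lattice -/

/-- The edges of the square lattice `ℤ × ℤ`: `horiz x y` joins `(x, y)` to `(x + 1, y)`, and
`vert x y` joins `(x, y)` to `(x, y + 1)`. -/
inductive LatticeEdge : Type
  | horiz (x y : ℤ)
  | vert (x y : ℤ)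
  deriving DecidableEq

namespace LatticeEdge

/-- The lower or left endpoint of an edge. -/
def src : LatticeEdge → ℤ × ℤ
  | horiz x y => (x, y)
  | vert x y => (x, y)

/-- The upper or right endpoint of an edge. -/
def tgt : LatticeEdge → ℤ × ℤ
  | horiz x y => (x + 1, y)
  | vert x y => (x, y + 1)

end LatticeEdge

/-- The four edges at a lattice vertex. -/
def edgesAt (v : ℤ × ℤ) : Finset LatticeEdge :=
  {.horiz v.1 v.2, .horiz (v.1 - 1) v.2, .vert v.1 v.2, .vert v.1 (v.2 - 1)}

/-- The four edges around the elementary plaquette with corners `(a, b)`, `(a + 1, b)`,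
`(a + 1, b + 1)`, `(a, b + 1)`. The plaquettes are identified with the vertices of the dual lattice:
`(a, b)` stands for the dual vertex at the point `(a + 1/2, b + 1/2)`. -/
def plaquetteEdges (p : ℤ × ℤ) : Finset LatticeEdge :=
  {.horiz p.1 p.2, .horiz p.1 (p.2 + 1), .vert p.1 p.2, .vert (p.1 + 1) p.2}

/-- The directions of the unit steps on the dual lattice. -/
inductive Dir : Type
  | east
  | north
  | west
  | south

namespace Dir

/-- The unit vector of a direction. -/
def vec : Dir → ℤ × ℤ
  | east => (1, 0)
  | north => (0, 1)
  | west => (-1, 0)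
  | south => (0, -1)

/-- The lattice edge crossed by the unit step in direction `d` from the dual vertex `p`. -/
def crossed (p : ℤ × ℤ) : Dir → LatticeEdge
  | east => .vert (p.1 + 1) p.2
  | north => .horiz p.1 (p.2 + 1)
  | west => .vert p.1 p.2
  | south => .horiz p.1 p.2

/-- The endpoint of the crossed edge that lies on the left of the step. -/
def left (p : ℤ × ℤ) : Dir → ℤ × ℤ
  | east => (p.1 + 1, p.2 + 1)
  | north => (p.1, p.2 + 1)
  | west => (p.1, p.2)
  | south => (p.1 + 1, p.2)

/-- The endpoint of the crossed edge that lies on the right of the step. -/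
def right (p : ℤ × ℤ) : Dir → ℤ × ℤ
  | east => (p.1 + 1, p.2)
  | north => (p.1 + 1, p.2 + 1)
  | west => (p.1, p.2 + 1)
  | south => (p.1, p.2)

theorem crossed_mem_edgesAt_left (p : ℤ × ℤ) (d : Dir) : d.crossed p ∈ edgesAt (d.left p) := by
  cases d <;> simp [crossed, left, edgesAt]

end Dir

/-! ### Domains, terminations and fully-packed loops -/

/-- A region `Λ` of the square lattice, bounded by a simple closed path of length `2 N` on the dual
lattice. The path is run counter-clockwise from a chosen starting point; it visits the dual vertices
`corner 0, corner 1, …`, the step from `corner k` to `corner (k + 1)` having direction `dir k`. The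
set `verts` of the vertices enclosed by the path is the finite set that is separated from
its complement exactly by the path: every step of the path has a vertex of the region on its left
and a vertex outside the region on its right, and every lattice edge with exactly one endpoint in
the region is crossed by the path. -/
structure LatticeDomain (N : ℕ) where
  pos : 0 < N
  corner : ZMod (2 * N) → ℤ × ℤ
  dir : ZMod (2 * N) → Dir
  corner_succ : ∀ k, corner (k + 1) = corner k + (dir k).vec
  corner_injective : Function.Injective corner
  verts : Finset (ℤ × ℤ)
  left_mem : ∀ k, (dir k).left (corner k) ∈ verts
  right_notMem : ∀ k, (dir k).right (corner k) ∉ verts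
  boundary_crossed : ∀ e : LatticeEdge, ¬ (e.src ∈ verts ↔ e.tgt ∈ verts) →
    ∃ k, (dir k).crossed (corner k) = e

namespace LatticeDomain

variable {N : ℕ} (Λ : LatticeDomain N)

/-- The edges of the domain (internal edges and boundary edges): the lattice edges with at least one
endpoint in the region. -/
abbrev Edge : Type := {e : LatticeEdge // e ∈ Λ.verts.biUnion edgesAt}

/-- The terminations of the domain, in cyclic order: the `k`-th one is the boundary edge crossed by
the `k`-th step of the boundary path (so that `corner (k + 1)` is the plaquette between the
terminations `k` and `k + 1`). -/
def term (k : Fin (2 * N)) : Λ.Edge :=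
  ⟨(Λ.dir (k.val : ZMod (2 * N))).crossed (Λ.corner (k.val : ZMod (2 * N))),
    Finset.mem_biUnion.2 ⟨_, Λ.left_mem _, Dir.crossed_mem_edgesAt_left _ _⟩⟩

/-- The fully-packed loop configurations: at every vertex of the region, two of the four edges are
black and two are white. -/
def IsFPL (φ : Λ.Edge → Bool) : Prop :=
  ∀ v ∈ Λ.verts, ∀ c : Bool,
    (Finset.univ.filter fun e : Λ.Edge => e.val ∈ edgesAt v ∧ φ e = c).card = 2

/-- The configurations in `Fpl(Λ; τ)`. -/
def IsFPLWith (τ : Fin (2 * N) → Bool) (φ : Λ.Edge → Bool) : Prop :=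
  Λ.IsFPL φ ∧ ∀ k, φ (Λ.term k) = τ k

/-- Two edges of the same colour meet at a vertex of the region. -/
def Consecutive (φ : Λ.Edge → Bool) (e f : Λ.Edge) : Prop :=
  φ e = φ f ∧ ∃ v ∈ Λ.verts, e.val ∈ edgesAt v ∧ f.val ∈ edgesAt v

/-- Two edges belong to the same monochromatic path (or cycle). -/
def SamePath (φ : Λ.Edge → Bool) : Λ.Edge → Λ.Edge → Prop :=
  Relation.ReflTransGen (Λ.Consecutive φ)

/-- `π` is the link pattern `π(φ)` of the configuration `φ` in `Fpl(Λ; τ)`: the black terminations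
being labelled in cyclic order, two distinct labels are partners in `π` if and only if a black open
path of `φ` has the two corresponding terminations as its ends. -/
def HasLinkPattern {m : ℕ} (τ : Fin (2 * N) → Bool) (h : (blackTerms τ).card = 2 * m)
    (φ : Λ.Edge → Bool) (π : LinkPattern m) : Prop :=
  ∀ i k : Fin (2 * m), π.partner i = k ↔
    i ≠ k ∧ Λ.SamePath φ (Λ.term ((blackTerms τ).orderEmbOfFin h i))
      (Λ.term ((blackTerms τ).orderEmbOfFin h k))

/-- The refined enumeration `Ψ_{Λ,τ}(π)`. -/
noncomputable def refinedCount {m : ℕ} (τ : Fin (2 * N) → Bool)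
    (h : (blackTerms τ).card = 2 * m) (π : LinkPattern m) : ℕ :=
  Nat.card {φ : Λ.Edge → Bool // Λ.IsFPLWith τ φ ∧ Λ.HasLinkPattern τ h φ π}

/-- The vector `∑ π, Ψ_{Λ,τ}(π) |π⟩` of `ℂ^{LP(m)}`, where `2 m` is the number of black
terminations. -/
noncomputable def state {m : ℕ} (τ : Fin (2 * N) → Bool) (h : (blackTerms τ).card = 2 * m) :
    LPSpace m :=
  ∑ π : LinkPattern m, (Λ.refinedCount τ h π : ℂ) • Finsupp.single π 1

/-! ### The glued graph and valid triplets -/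

/-- The vertices of the graph `G_+(Λ)` in which the terminations of each pair are glued: the (degree
four) vertices of the region, and one vertex of degree two for each pair. -/
abbrev GluedVertex : Type := {v : ℤ × ℤ // v ∈ Λ.verts} ⊕ Fin N

/-- Incidence of edges and vertices in the graph `G_+(Λ)`, whose edges are those of `Λ`. -/
def GluedIncident (e : Λ.Edge) : Λ.GluedVertex → Prop
  | .inl v => e.val ∈ edgesAt v.val
  | .inr i => e = Λ.term (fstTerm i) ∨ e = Λ.term (sndTerm i)

/-- The set `V''(τ)`: the vertices of degree two with one black and one white edge. -/
def mixedVertices (τ : Fin (2 * N) → Bool) : Set Λ.GluedVertex :=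
  {x | ∃ i : Fin N, x = .inr i ∧ τ (fstTerm i) ≠ τ (sndTerm i)}

/-- The edges of the domain around the plaquette `p`. -/
def cycleAt (p : ℤ × ℤ) : Finset Λ.Edge :=
  Finset.univ.filter fun e => e.val ∈ plaquetteEdges p

/-- The collection `Γ` of the cycles of `G_+(Λ)`, as sets of edges, given by the plaquettes of
the parity of those that lie between the two terminations of a pair. -/
def gyrationCycles : Set (Finset Λ.Edge) :=
  {γ | γ.Nonempty ∧ ∃ p : ℤ × ℤ,
    Even ((p.1 + p.2) - ((Λ.corner 1).1 + (Λ.corner 1).2)) ∧ γ = Λ.cycleAt p}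

/-- The triplet `(G_+(Λ), τ, Γ)` is valid: all cycles in `Γ` have length at most four, and those
adjacent to a vertex of `V''(τ)` have length at most three. -/
def ValidTriplet (τ : Fin (2 * N) → Bool) : Prop :=
  (∀ γ ∈ Λ.gyrationCycles, γ.card ≤ 4) ∧
  ∀ γ ∈ Λ.gyrationCycles, ∀ x ∈ Λ.mixedVertices τ,
    (∃ e ∈ γ, Λ.GluedIncident e x) → γ.card ≤ 3

end LatticeDomain

/-! The gyration inverts all colours, except around the plaquettes of the parity of `Γ` whose four
corners belong to the region and whose four edges alternate in colour. At every vertex two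
plaquettes of this parity meet, each of which contributes two edges, and counting the black edges
before and after shows that the result is again a fully packed configuration, with complementary
boundary condition; the map is an involution.

It preserves connectivity in the glued graph: validity makes the black edges around a
non-alternating plaquette lie on one path, and so do the formerly white edges that replace them,
while consecutive black edges have replacements that meet at their common vertex. On the other hand,
the operators `c_j` at the (black, black) pairs turn the link pattern of a configuration into the
pairing of the mixed pairs by the paths of the glued graph. Summing over all configurations gives
the identity.

That a configuration has a link pattern rests on two facts: a path that starts at a termination has
exactly two ends, by counting degrees, and paths of the same colour do not cross. The indicator of a
path is, modulo `2`, the coboundary of a function on the plaquettes; this function is constant along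
every other path of that colour, but it takes different values on the two arcs of the boundary. -/

/-! ### Generated equivalence relations -/

section GeneratedSetoid

variable {X : Type*}

/-- The smallest equivalence relation that identifies the points `a` and `b`. -/
def identify (a b : X) : Setoid X :=
  Relation.EqvGen.setoid fun x y => x = a ∧ y = b

theorem identify_le_iff {a b : X} {T : Setoid X} : identify a b ≤ T ↔ T a b := by
  rw [identify, Setoid.gi.gc.le_iff_le]
  exact ⟨fun h => h a b ⟨rfl, rfl⟩, by rintro h _ _ ⟨rfl, rfl⟩; exact h⟩

theorem sup_identify_apply (S : Setoid X) (a b x y : X) :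
    (S ⊔ identify a b) x y ↔ S x y ∨ S x a ∧ S b y ∨ S x b ∧ S a y := by
  constructor
  · let M : Setoid X :=
      { r x y := S x y ∨ S x a ∧ S b y ∨ S x b ∧ S a y
        iseqv := by
          have symm {u v} (h : S u v) : S v u := S.symm h
          have trans {u v w} (h : S u v) (k : S v w) : S u w := S.trans h k
          exact ⟨fun x => .inl (S.refl x), by grind, by grind⟩ }
    have hM : S ⊔ identify a b ≤ M :=
      sup_le (fun _ _ h => .inl h) (identify_le_iff.2 (.inr (.inl ⟨S.refl a, S.refl b⟩)))
    exact fun h => hM h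
  · have hS {u v} (h : S u v) : (S ⊔ identify a b) u v := (le_sup_left : S ≤ _) h
    have hab : (S ⊔ identify a b) a b := identify_le_iff.1 le_sup_right
    rintro (h | ⟨h, h'⟩ | ⟨h, h'⟩)
    · exact hS h
    · exact Setoid.trans' _ (hS h) (Setoid.trans' _ hab (hS h'))
    · exact Setoid.trans' _ (hS h) (Setoid.trans' _ (Setoid.symm' _ hab) (hS h'))

end GeneratedSetoid

/-! ### Closing link patterns -/

namespace LinkPattern

variable {X : Type*} {m n : ℕ}

/-- The link pattern `π` matches the points according to the equivalence relation `S` on their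
positions `pos`: two distinct points are partners if and only if their positions are equivalent. -/
def Represents (π : LinkPattern m) (pos : Fin (2 * m) → X) (S : Setoid X) : Prop :=
  ∀ i k, π.partner i = k ↔ i ≠ k ∧ S (pos i) (pos k)

theorem Represents.unique {π ρ : LinkPattern m} {pos : Fin (2 * m) → X} {S : Setoid X}
    (h : π.Represents pos S) (h' : ρ.Represents pos S) : π = ρ := by
  ext1
  funext i
  exact (h i _).2 ((h' i _).1 rfl)

theorem Represents.joined_eq_iff {π : LinkPattern m} {pos : Fin (2 * m) → X} {S : Setoid X}
    (h : π.Represents pos S) {a b x y : Fin (2 * m)} (hxa : x ≠ a) (hxb : x ≠ b) (hya : y ≠ a)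
    (hyb : y ≠ b) (hab : a ≠ b) :
    π.joined a b x = y ↔ x ≠ y ∧ (S ⊔ identify (pos a) (pos b)) (pos x) (pos y) := by
  have partner_iff : ∀ u v, u ≠ v → (S (pos u) (pos v) ↔ π.partner u = v) := fun u v huv => by
    rw [h u v, and_iff_right huv]
  rw [sup_identify_apply, partner_iff x a hxa, partner_iff x b hxb, partner_iff a y hya.symm,
    partner_iff b y hyb.symm]
  rcases eq_or_ne x y with rfl | hxy
  · simp [π.joined_self_ne hab]
  · rw [partner_iff x y hxy]
    unfold joined
    split_ifs <;> grind [π.partner_partner]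

theorem Represents.close {j : ℕ} {π : LinkPattern (m + 1)} {pos : Fin (2 * (m + 1)) → X}
    {S : Setoid X} (h : π.Represents pos S) (hj : j + 1 < 2 * (m + 1)) :
    (close j hj π).Represents (pos ∘ skip j)
      (S ⊔ identify (pos ⟨j, by omega⟩) (pos ⟨j + 1, hj⟩)) := by
  intro i k
  have skip_ne_pair (i : Fin (2 * m)) :
      skip j i ≠ ⟨j, by omega⟩ ∧ skip j i ≠ (⟨j + 1, hj⟩ : Fin (2 * (m + 1))) := by
    simpa only [ne_eq, Fin.ext_iff] using skip_ne (j := j) i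
  rw [← skip_injective.eq_iff (f := skip j), skip_close_partner, ← skip_injective.ne_iff]
  exact h.joined_eq_iff (skip_ne_pair i).1 (skip_ne_pair i).2 (skip_ne_pair k).1 (skip_ne_pair k).2
    (by simp)

theorem skip_val_of_lt {j : ℕ} {i : Fin (2 * n)} (h : i.val < j) : (skip j i).val = i.val := by
  simp [skip, h]

theorem skip_val_of_le {j : ℕ} {i : Fin (2 * n)} (h : j ≤ i.val) :
    (skip j i).val = i.val + 2 := by
  simp [skip, not_lt.2 h]

/-- The increasing relabelling of the points that are left once the pairs `j`, `j + 1` with `j ∈ L`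
have been removed one after the other, starting from the head of `L`. -/
def keep (n : ℕ) : (L : List ℕ) → Fin (2 * n) → Fin (2 * (n + L.length))
  | [] => id
  | j :: L => skip j ∘ keep n L

theorem keep_strictMono : ∀ L : List ℕ, StrictMono (keep n L)
  | [] => strictMono_id
  | j :: L => StrictMono.comp (fun i k => (skip_lt_iff (j := j) i k).2) (keep_strictMono L)

theorem keep_ne {L : List ℕ} (hL : L.Pairwise fun a b => b + 1 < a) (i : Fin (2 * n)) :
    ∀ j ∈ L, (keep n L i).val ≠ j ∧ (keep n L i).val ≠ j + 1 := by
  induction L with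
  | nil => simp
  | cons j L ih =>
    rw [List.pairwise_cons] at hL
    intro l hl
    change (skip j (keep n L i)).val ≠ l ∧ (skip j (keep n L i)).val ≠ l + 1
    rcases List.mem_cons.1 hl with rfl | hl
    · exact skip_ne _
    · have hlj := hL.1 l hl
      have hne := ih hL.2 l hl
      rcases lt_or_ge (keep n L i).val j with h | h
      · rwa [skip_val_of_lt h]
      · rw [skip_val_of_le h]
        omega

/-- The equivalence relation generated by joining the points `j` and `j + 1` for all `j ∈ L`. -/
def arcs (pos : Fin m → X) (L : List ℕ) : Setoid X :=
  Relation.EqvGen.setoid fun x y =>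
    ∃ a b : Fin m, a.val ∈ L ∧ b.val = a.val + 1 ∧ pos a = x ∧ pos b = y

theorem arcs_le_iff {pos : Fin m → X} {L : List ℕ} {T : Setoid X} :
    arcs pos L ≤ T ↔ ∀ a b : Fin m, a.val ∈ L → b.val = a.val + 1 → T (pos a) (pos b) := by
  rw [arcs, Setoid.gi.gc.le_iff_le]
  exact ⟨fun h a b ha hab => h _ _ ⟨a, b, ha, hab, rfl, rfl⟩,
    by rintro h _ _ ⟨a, b, ha, hab, rfl, rfl⟩; exact h a b ha hab⟩

theorem arcs_nil (pos : Fin m → X) : arcs pos [] = ⊥ :=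
  le_bot_iff.1 (arcs_le_iff.2 (by simp))

theorem arcs_cons {pos : Fin (2 * (n + 1)) → X} {j : ℕ} {L : List ℕ} (hj : j + 1 < 2 * (n + 1))
    (hL : ∀ l ∈ L, l + 1 < j) :
    arcs pos (j :: L) =
      identify (pos ⟨j, by omega⟩) (pos ⟨j + 1, hj⟩) ⊔ arcs (pos ∘ skip (n := n) j) L := by
  refine eq_of_forall_ge_iff fun T => ?_
  simp only [sup_le_iff, identify_le_iff, arcs_le_iff, List.mem_cons, Function.comp_apply]
  constructor
  · refine fun h => ⟨h _ _ (.inl rfl) rfl, fun a b ha hab => ?_⟩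
    have haj := hL _ ha
    exact h _ _ (.inr (by rwa [skip_val_of_lt (by omega)]))
      (by rw [skip_val_of_lt (by omega), skip_val_of_lt (by omega), hab])
  · rintro ⟨hhead, htail⟩ a b (ha | ha) hab
    · convert hhead using 2 <;> exact Fin.ext (by lia)
    · have haj := hL _ ha
      have exists_skip_eq (c : Fin (2 * (n + 1))) (hc : c.val < j) :
          ∃ c' : Fin (2 * n), c'.val = c.val ∧ skip j c' = c :=
        ⟨⟨c.val, by omega⟩, rfl, Fin.ext (skip_val_of_lt hc)⟩
      obtain ⟨a', haa', rfl⟩ := exists_skip_eq a (by omega)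
      obtain ⟨b', hbb', rfl⟩ := exists_skip_eq b (by omega)
      exact htail a' b' (haa' ▸ ha) (by omega)

theorem closeOp_single {j : ℕ} (hj : j + 1 < 2 * (n + 1)) (π : LinkPattern (n + 1)) :
    closeOp n j (Finsupp.single π 1) = Finsupp.single (close j hj π) 1 := by
  simp [closeOp, hj]

theorem Represents.exists_closeList {L : List ℕ} (hL : L.Pairwise fun a b => b + 1 < a)
    (hlt : ∀ j ∈ L, j + 1 < 2 * (n + L.length)) {π : LinkPattern (n + L.length)}
    {pos : Fin (2 * (n + L.length)) → X} {S : Setoid X} (hπ : π.Represents pos S) :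
    ∃ ρ : LinkPattern n, closeList n L (Finsupp.single π 1) = Finsupp.single ρ 1 ∧
      ρ.Represents (pos ∘ keep n L) (S ⊔ arcs pos L) := by
  induction L generalizing S with
  | nil => exact ⟨π, rfl, by rwa [arcs_nil, sup_bot_eq]⟩
  | cons j L ih =>
    rw [List.pairwise_cons] at hL
    have hj : j + 1 < 2 * (n + L.length + 1) := hlt j (by simp)
    obtain ⟨ρ, hclose, hρ⟩ :=
      ih hL.2 (fun l hl => by have := hL.1 l hl; omega) (Represents.close hπ hj)
    refine ⟨ρ, ?_, ?_⟩
    · rw [closeList, LinearMap.comp_apply, closeOp_single hj, hclose]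
    · rwa [sup_assoc, ← arcs_cons hj hL.1] at hρ

end LinkPattern

/-! ### Labels of the black terminations -/

section Labels

variable {N : ℕ} (τ : Fin (2 * N) → Bool)

theorem mem_blackTerms {k : Fin (2 * N)} : k ∈ blackTerms τ ↔ τ k = true := by
  simp [blackTerms]

theorem mem_bbPairs {i : Fin N} :
    i ∈ bbPairs τ ↔ τ (fstTerm i) = true ∧ τ (sndTerm i) = true := by
  simp [bbPairs]

theorem mem_mixedPairs {i : Fin N} : i ∈ mixedPairs τ ↔ τ (fstTerm i) ≠ τ (sndTerm i) := by
  simp [mixedPairs]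

theorem mem_bbIndices {j : ℕ} :
    j ∈ bbIndices τ ↔ ∃ i ∈ bbPairs τ, blackLabel τ (fstTerm i) = j := by
  simp [bbIndices]

theorem exists_orderEmbOfFin_eq {c : ℕ} (hc : (blackTerms τ).card = c) {k : Fin (2 * N)}
    (hk : τ k = true) : ∃ a, (blackTerms τ).orderEmbOfFin hc a = k := by
  rwa [← Set.mem_range, Finset.range_orderEmbOfFin, Finset.mem_coe, mem_blackTerms]

theorem blackLabel_orderEmbOfFin {c : ℕ} (hc : (blackTerms τ).card = c) (a : Fin c) :
    blackLabel τ ((blackTerms τ).orderEmbOfFin hc a) = a := by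
  have hlt : (blackTerms τ).filter (· < (blackTerms τ).orderEmbOfFin hc a) =
      (Finset.Iio a).map ((blackTerms τ).orderEmbOfFin hc).toEmbedding := by
    ext k
    simp only [Finset.mem_filter, Finset.mem_map, Finset.mem_Iio]
    constructor
    · rintro ⟨hk, h⟩
      obtain ⟨b, rfl⟩ := exists_orderEmbOfFin_eq τ hc ((mem_blackTerms τ).1 hk)
      exact ⟨b, by simpa using h, rfl⟩
    · rintro ⟨b, h, rfl⟩
      exact ⟨Finset.orderEmbOfFin_mem _ hc b, by simpa using h⟩
  rw [blackLabel, hlt, Finset.card_map, Fin.card_Iio]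

theorem orderEmbOfFin_blackTerms_eq_iff {c : ℕ} (hc : (blackTerms τ).card = c) {k : Fin (2 * N)}
    (hk : τ k = true) {a : Fin c} :
    (blackTerms τ).orderEmbOfFin hc a = k ↔ a.val = blackLabel τ k := by
  obtain ⟨b, rfl⟩ := exists_orderEmbOfFin_eq τ hc hk
  rw [blackLabel_orderEmbOfFin, Fin.val_inj, EmbeddingLike.apply_eq_iff_eq]

theorem blackLabel_sndTerm {i : Fin N} (h : τ (fstTerm i) = true) :
    blackLabel τ (sndTerm i) = blackLabel τ (fstTerm i) + 1 := by
  have hlt : (blackTerms τ).filter (· < sndTerm i) =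
      insert (fstTerm i) ((blackTerms τ).filter (· < fstTerm i)) := by
    ext l
    have : l < sndTerm i ↔ l = fstTerm i ∨ l < fstTerm i := by
      simp only [fstTerm, sndTerm, Fin.ext_iff, Fin.lt_def]
      omega
    simp only [Finset.mem_filter, Finset.mem_insert, mem_blackTerms, this]
    grind
  rw [blackLabel, hlt, Finset.card_insert_of_notMem (by simp), blackLabel]

theorem bbIndices_arc_iff {c : ℕ} (hc : (blackTerms τ).card = c) {a b : Fin c} :
    a.val ∈ bbIndices τ ∧ b.val = a.val + 1 ↔
      ∃ i ∈ bbPairs τ, (blackTerms τ).orderEmbOfFin hc a = fstTerm i ∧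
        (blackTerms τ).orderEmbOfFin hc b = sndTerm i := by
  rw [mem_bbIndices, ← exists_and_right]
  refine exists_congr fun i => ?_
  rw [and_assoc]
  refine and_congr_right fun hi => ?_
  rw [mem_bbPairs] at hi
  rw [orderEmbOfFin_blackTerms_eq_iff τ hc hi.1, orderEmbOfFin_blackTerms_eq_iff τ hc hi.2,
    blackLabel_sndTerm τ hi.1]
  grind

theorem add_one_lt_of_mem_bbIndices {j : ℕ} (hj : j ∈ bbIndices τ) :
    j + 1 < (blackTerms τ).card := by
  obtain ⟨i, hi, rfl⟩ := (mem_bbIndices τ).1 hj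
  rw [mem_bbPairs] at hi
  obtain ⟨a, ha⟩ := exists_orderEmbOfFin_eq τ rfl hi.2
  rw [← blackLabel_sndTerm τ hi.1, ← ha, blackLabel_orderEmbOfFin]
  exact a.isLt

theorem add_one_notMem_bbIndices {j : ℕ} (hj : j ∈ bbIndices τ) : j + 1 ∉ bbIndices τ := by
  intro hj'
  have hlt := add_one_lt_of_mem_bbIndices τ hj'
  obtain ⟨i, -, -, hi⟩ :=
    (bbIndices_arc_iff τ rfl (a := ⟨j, by omega⟩) (b := ⟨j + 1, by omega⟩)).1 ⟨hj, rfl⟩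
  obtain ⟨i', -, hi', -⟩ :=
    (bbIndices_arc_iff τ rfl (a := ⟨j + 1, by omega⟩) (b := ⟨j + 1 + 1, hlt⟩)).1 ⟨hj', rfl⟩
  have h := hi.symm.trans hi'
  simp only [fstTerm, sndTerm, Fin.ext_iff] at h
  omega

theorem pairwise_sort_bbIndices :
    ((bbIndices τ).sort (· ≥ ·)).Pairwise fun a b => b + 1 < a := by
  refine (Finset.sortedGT_sort (bbIndices τ)).pairwise.imp_of_mem fun {a b} ha hb hab => ?_
  rw [Finset.mem_sort] at ha hb
  refine lt_of_le_of_ne hab fun h => ?_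
  exact add_one_notMem_bbIndices τ hb (h ▸ ha)

/-- The pair that contains a given termination. -/
def pairOf (k : Fin (2 * N)) : Fin N := ⟨k.val / 2, by omega⟩

theorem pairOf_fstTerm (i : Fin N) : pairOf (fstTerm i) = i := by
  simp [pairOf, fstTerm]

theorem pairOf_sndTerm (i : Fin N) : pairOf (sndTerm i) = i := by
  simp only [pairOf, sndTerm, Fin.ext_iff]
  omega

theorem eq_fstTerm_or_sndTerm (k : Fin (2 * N)) :
    k = fstTerm (pairOf k) ∨ k = sndTerm (pairOf k) := by
  simp only [fstTerm, sndTerm, pairOf, Fin.ext_iff]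
  omega

/-- The black termination of a mixed pair (for the other pairs the value is irrelevant). -/
def pairBlack (i : Fin N) : Fin (2 * N) := if τ (fstTerm i) = true then fstTerm i else sndTerm i

theorem pairOf_pairBlack (i : Fin N) : pairOf (pairBlack τ i) = i := by
  unfold pairBlack
  split_ifs
  · exact pairOf_fstTerm i
  · exact pairOf_sndTerm i

variable {τ}

theorem pairBlack_black {i : Fin N} (hi : i ∈ mixedPairs τ) : τ (pairBlack τ i) = true := by
  rw [mem_mixedPairs] at hi
  unfold pairBlack
  split_ifs <;> grind

theorem pairBlack_pairOf {k : Fin (2 * N)} (hk : τ k = true) (hmixed : pairOf k ∈ mixedPairs τ) :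
    pairBlack τ (pairOf k) = k := by
  rw [mem_mixedPairs] at hmixed
  unfold pairBlack
  rcases eq_fstTerm_or_sndTerm k with h | h <;> split_ifs <;> grind

theorem pairOf_mem_bbPairs_or_mixedPairs {k : Fin (2 * N)} (hk : τ k = true) :
    pairOf k ∈ bbPairs τ ∨ pairOf k ∈ mixedPairs τ := by
  rw [mem_bbPairs, mem_mixedPairs]
  rcases eq_fstTerm_or_sndTerm k with h | h <;> grind

variable {X : Type*}

variable (τ) in
/-- The equivalence relation generated by gluing, in every (black, black) pair, the positions of the
two terminations. -/
def gluing (pos : Fin (2 * N) → X) : Setoid X :=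
  Relation.EqvGen.setoid fun x y =>
    ∃ i ∈ bbPairs τ, pos (fstTerm i) = x ∧ pos (sndTerm i) = y

theorem gluing_le_iff {pos : Fin (2 * N) → X} {T : Setoid X} :
    gluing τ pos ≤ T ↔ ∀ i ∈ bbPairs τ, T (pos (fstTerm i)) (pos (sndTerm i)) := by
  rw [gluing, Setoid.gi.gc.le_iff_le]
  exact ⟨fun h i hi => h _ _ ⟨i, hi, rfl, rfl⟩, by rintro h _ _ ⟨i, hi, rfl, rfl⟩; exact h i hi⟩

theorem gluing_apply (pos : Fin (2 * N) → X) {k l : Fin (2 * N)} (hkl : pairOf k = pairOf l)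
    (hk : τ k = true) (hl : τ l = true) : gluing τ pos (pos k) (pos l) := by
  have hpair := gluing_le_iff.1 (le_refl (gluing τ pos)) (pairOf k)
  rw [mem_bbPairs] at hpair
  rcases eq_fstTerm_or_sndTerm k with h | h <;> rcases eq_fstTerm_or_sndTerm l with h' | h' <;>
    rw [← hkl] at h'
  · rw [h, h']
  · rw [h, h']
    exact hpair ⟨h ▸ hk, h' ▸ hl⟩
  · rw [h, h']
    exact Setoid.symm' _ (hpair ⟨h' ▸ hl, h ▸ hk⟩)
  · rw [h, h']

theorem arcs_bbIndices (pos : Fin (2 * N) → X) {c : ℕ} (hc : (blackTerms τ).card = c) :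
    LinkPattern.arcs (pos ∘ (blackTerms τ).orderEmbOfFin hc) ((bbIndices τ).sort (· ≥ ·)) =
      gluing τ pos := by
  refine eq_of_forall_ge_iff fun T => ?_
  simp only [LinkPattern.arcs_le_iff, gluing_le_iff, Finset.mem_sort, Function.comp_apply]
  constructor
  · intro h i hi
    obtain ⟨a, ha⟩ := exists_orderEmbOfFin_eq τ hc ((mem_bbPairs τ).1 hi).1
    obtain ⟨b, hb⟩ := exists_orderEmbOfFin_eq τ hc ((mem_bbPairs τ).1 hi).2
    have hab := (bbIndices_arc_iff τ hc).2 ⟨i, hi, ha, hb⟩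
    simpa only [ha, hb] using h a b hab.1 hab.2
  · intro h a b ha hab
    obtain ⟨i, hi, hia, hib⟩ := (bbIndices_arc_iff τ hc).1 ⟨ha, hab⟩
    rw [hia, hib]
    exact h i hi

/-- The black terminations outside the (black, black) pairs are those of the mixed pairs, in the
same order, since distinct black terminations of this kind lie in distinct pairs. -/
theorem pairBlack_comp_orderEmbOfFin {n c : ℕ} (hn : (mixedPairs τ).card = 2 * n)
    (hc : (blackTerms τ).card = c) {s : Fin (2 * n) → Fin c} (hs : StrictMono s)
    (hne : ∀ a, ∀ j ∈ bbIndices τ, (s a).val ≠ j ∧ (s a).val ≠ j + 1) :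
    pairBlack τ ∘ (mixedPairs τ).orderEmbOfFin hn = (blackTerms τ).orderEmbOfFin hc ∘ s := by
  set emb := (blackTerms τ).orderEmbOfFin hc
  have hblack (x) : τ (emb x) = true := (mem_blackTerms τ).1 (Finset.orderEmbOfFin_mem _ hc x)
  have hmixed (a) : pairOf (emb (s a)) ∈ mixedPairs τ := by
    refine (pairOf_mem_bbPairs_or_mixedPairs (hblack (s a))).resolve_left fun hbb => ?_
    obtain ⟨x, hx⟩ := exists_orderEmbOfFin_eq τ hc ((mem_bbPairs τ).1 hbb).1
    obtain ⟨y, hy⟩ := exists_orderEmbOfFin_eq τ hc ((mem_bbPairs τ).1 hbb).2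
    have hxy := (bbIndices_arc_iff τ hc).2 ⟨_, hbb, hx, hy⟩
    have hsx := hne a _ hxy.1
    rcases eq_fstTerm_or_sndTerm (emb (s a)) with h | h
    · exact hsx.1 (congrArg Fin.val (emb.injective (h.trans hx.symm)))
    · exact hsx.2 ((congrArg Fin.val (emb.injective (h.trans hy.symm))).trans hxy.2)
  have hpair (a) : pairBlack τ (pairOf (emb (s a))) = emb (s a) :=
    pairBlack_pairOf (hblack _) (hmixed a)
  have hmono : StrictMono fun a => pairOf (emb (s a)) := fun a b hab => by
    have hlt : emb (s a) < emb (s b) := emb.strictMono (hs hab)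
    refine lt_of_le_of_ne (Nat.div_le_div_right hlt.le) fun h => hlt.ne ?_
    rw [← hpair a, ← hpair b]
    exact congrArg _ h
  rw [← Finset.orderEmbOfFin_unique hn hmixed hmono]
  exact funext hpair

theorem LinkPattern.Represents.exists_closeProd {n : ℕ} (hn : (mixedPairs τ).card = 2 * n)
    {π : LinkPattern (n + ((bbIndices τ).sort (· ≥ ·)).length)} {pos : Fin (2 * N) → X}
    {S : Setoid X}
    (hπ : π.Represents (pos ∘ (blackTerms τ).orderEmbOfFin (card_blackTerms_eq τ hn)) S) :
    ∃ ρ : LinkPattern n, closeProd n (bbIndices τ) (Finsupp.single π 1) = Finsupp.single ρ 1 ∧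
      ρ.Represents (pos ∘ pairBlack τ ∘ (mixedPairs τ).orderEmbOfFin hn) (S ⊔ gluing τ pos) := by
  have hgap := pairwise_sort_bbIndices τ
  obtain ⟨ρ, hclose, hρ⟩ := hπ.exists_closeList hgap fun j hj =>
    card_blackTerms_eq τ hn ▸ add_one_lt_of_mem_bbIndices τ ((Finset.mem_sort _).1 hj)
  refine ⟨ρ, hclose, ?_⟩
  rwa [pairBlack_comp_orderEmbOfFin hn (card_blackTerms_eq τ hn) (LinkPattern.keep_strictMono _)
    fun a j hj => LinkPattern.keep_ne hgap a j ((Finset.mem_sort _).2 hj), ← arcs_bbIndices]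

end Labels

/-! ### Edges and plaquettes -/

theorem mem_edgesAt {e : LatticeEdge} {v : ℤ × ℤ} : e ∈ edgesAt v ↔ e.src = v ∨ e.tgt = v := by
  obtain ⟨a, b⟩ := v
  cases e <;> simp [edgesAt, LatticeEdge.src, LatticeEdge.tgt] <;> omega

theorem sum_edgesAt {M : Type*} [AddCommMonoid M] (f : LatticeEdge → M) (v : ℤ × ℤ) :
    ∑ e ∈ edgesAt v, f e =
      f (.horiz v.1 v.2) + (f (.horiz (v.1 - 1) v.2) + (f (.vert v.1 v.2) +
        f (.vert v.1 (v.2 - 1)))) := by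
  rw [edgesAt, Finset.sum_insert (by simp; omega), Finset.sum_insert (by simp),
    Finset.sum_insert (by simp; omega), Finset.sum_singleton]

theorem card_edgesAt (v : ℤ × ℤ) : (edgesAt v).card = 4 := by
  simp only [Finset.card_eq_sum_ones, sum_edgesAt, Nat.reduceAdd]

namespace LatticeEdge

/-- The plaquette below or on the left of an edge. -/
def lowFace : LatticeEdge → ℤ × ℤ
  | horiz x y => (x, y - 1)
  | vert x y => (x - 1, y)

/-- The plaquette above or on the right of an edge. -/
def highFace : LatticeEdge → ℤ × ℤ
  | horiz x y => (x, y)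
  | vert x y => (x, y)

end LatticeEdge

namespace Dir

/-- The direction after a quarter turn to the left. The sides `d.crossed p` and `d.next.crossed p`
of the plaquette `p` follow each other counter-clockwise and meet at the corner `d.left p`. -/
def next : Dir → Dir
  | east => north
  | north => west
  | west => south
  | south => east

theorem next_right (p : ℤ × ℤ) (d : Dir) : d.next.right p = d.left p := by
  cases d <;> rfl

theorem next_next_next_next (d : Dir) : d.next.next.next.next = d := by
  cases d <;> rfl

theorem eq_or_eq_next (c d : Dir) :
    c = d ∨ c = d.next ∨ c = d.next.next ∨ c = d.next.next.next := by
  cases c <;> cases d <;> simp [next]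

theorem crossed_injective (p : ℤ × ℤ) : Function.Injective (crossed p) := by
  intro c d h
  cases c <;> cases d <;> simp_all [crossed]

theorem left_injective (p : ℤ × ℤ) : Function.Injective fun d : Dir => d.left p := by
  intro c d h
  obtain ⟨a, b⟩ := p
  cases c <;> cases d <;> simp [left] at h ⊢

theorem crossed_mem_edgesAt {p v : ℤ × ℤ} {d : Dir} :
    d.crossed p ∈ edgesAt v ↔ v = d.left p ∨ v = d.right p := by
  rw [mem_edgesAt]
  cases d <;> simp only [crossed, left, right, LatticeEdge.src, LatticeEdge.tgt] <;> grind

theorem exists_left_eq {p v : ℤ × ℤ} {d : Dir} (h : d.crossed p ∈ edgesAt v) :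
    ∃ c : Dir, c.left p = v ∧ (d = c ∨ d = c.next) := by
  rcases crossed_mem_edgesAt.1 h with rfl | rfl
  · exact ⟨d, rfl, .inl rfl⟩
  · exact ⟨d.next.next.next, by rw [← next_right, next_next_next_next],
      .inr d.next_next_next_next.symm⟩

theorem crossed_faces (p : ℤ × ℤ) (d : Dir) :
    ((d.crossed p).lowFace = p ∧ (d.crossed p).highFace = p + d.vec) ∨
      ((d.crossed p).lowFace = p + d.vec ∧ (d.crossed p).highFace = p) := by
  obtain ⟨a, b⟩ := p
  cases d <;> simp [crossed, vec, LatticeEdge.lowFace, LatticeEdge.highFace] <;> omega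

theorem exists_crossed_eq_iff {p : ℤ × ℤ} {e : LatticeEdge} :
    (∃ d : Dir, d.crossed p = e) ↔ e.lowFace = p ∨ e.highFace = p := by
  constructor
  · rintro ⟨d, rfl⟩
    rcases crossed_faces p d with h | h
    exacts [.inl h.1, .inr h.2]
  · rintro (rfl | rfl) <;> cases e
    · exact ⟨north, by simp [crossed, LatticeEdge.lowFace]⟩
    · exact ⟨east, by simp [crossed, LatticeEdge.lowFace]⟩
    · exact ⟨south, rfl⟩
    · exact ⟨west, rfl⟩

theorem mem_plaquetteEdges_iff {p : ℤ × ℤ} {e : LatticeEdge} :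
    e ∈ plaquetteEdges p ↔ ∃ d : Dir, d.crossed p = e := by
  simp only [plaquetteEdges, Finset.mem_insert, Finset.mem_singleton]
  constructor
  · rintro (rfl | rfl | rfl | rfl)
    exacts [⟨south, rfl⟩, ⟨north, rfl⟩, ⟨west, rfl⟩, ⟨east, rfl⟩]
  · rintro ⟨d, rfl⟩
    cases d <;> simp [crossed]

theorem eq_or_left_eq_right_of_crossed_eq {p p' : ℤ × ℤ} {d d' : Dir}
    (h : d.crossed p = d'.crossed p') : p = p' ∨ d.left p = d'.right p' := by
  obtain ⟨a, b⟩ := p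
  obtain ⟨a', b'⟩ := p'
  cases d <;> cases d' <;> simp [crossed, left, right] at h ⊢ <;> omega

end Dir

namespace LatticeDomain

variable {N : ℕ} (Λ : LatticeDomain N)

/-! ### Terminations -/

/-- An edge with exactly one endpoint in the region. -/
def IsBoundary (e : LatticeEdge) : Prop := ¬ (e.src ∈ Λ.verts ↔ e.tgt ∈ Λ.verts)

theorem mem_edges_iff {e : LatticeEdge} :
    e ∈ Λ.verts.biUnion edgesAt ↔ e.src ∈ Λ.verts ∨ e.tgt ∈ Λ.verts := by
  simp only [Finset.mem_biUnion, mem_edgesAt]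
  grind

theorem isBoundary_crossed_iff {p : ℤ × ℤ} {d : Dir} :
    Λ.IsBoundary (d.crossed p) ↔ ¬ (d.left p ∈ Λ.verts ↔ d.right p ∈ Λ.verts) := by
  cases d <;> simp only [IsBoundary, Dir.crossed, Dir.left, Dir.right, LatticeEdge.src,
    LatticeEdge.tgt, iff_comm]

theorem crossed_mem_edges_iff {p : ℤ × ℤ} {d : Dir} :
    d.crossed p ∈ Λ.verts.biUnion edgesAt ↔ d.left p ∈ Λ.verts ∨ d.right p ∈ Λ.verts := by
  rw [mem_edges_iff]
  cases d <;> simp only [Dir.crossed, Dir.left, Dir.right, LatticeEdge.src, LatticeEdge.tgt,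
    or_comm]

theorem isBoundary_term (k : Fin (2 * N)) : Λ.IsBoundary (Λ.term k).val :=
  Λ.isBoundary_crossed_iff.2 fun h => Λ.right_notMem _ (h.1 (Λ.left_mem _))

theorem natCast_zmod_injOn : Set.InjOn (Nat.cast : ℕ → ZMod (2 * N)) (Set.Iio (2 * N)) := by
  intro a ha b hb h
  rwa [ZMod.natCast_eq_natCast_iff', Nat.mod_eq_of_lt ha, Nat.mod_eq_of_lt hb] at h

theorem term_injective : Function.Injective Λ.term := fun k l h => by
  rcases Dir.eq_or_left_eq_right_of_crossed_eq (congrArg Subtype.val h) with h' | h'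
  · exact Fin.ext (natCast_zmod_injOn k.2 l.2 (Λ.corner_injective h'))
  · exact absurd (Λ.left_mem k.val) (h' ▸ Λ.right_notMem l.val)

theorem exists_term_eq {e : Λ.Edge} (h : Λ.IsBoundary e.val) : ∃ k, Λ.term k = e := by
  have : NeZero (2 * N) := ⟨by have := Λ.pos; omega⟩
  obtain ⟨k, hk⟩ := Λ.boundary_crossed e.val h
  exact ⟨⟨k.val, ZMod.val_lt k⟩, Subtype.ext (by simpa [term] using hk)⟩

theorem faces_term {k : Fin (2 * N)} {p : ℤ × ℤ} :
    (∃ d : Dir, d.crossed p = (Λ.term k).val) ↔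
      Λ.corner (k.val : ZMod (2 * N)) = p ∨ Λ.corner ((k.val + 1 : ℕ) : ZMod (2 * N)) = p := by
  rw [Dir.exists_crossed_eq_iff, Nat.cast_add, Nat.cast_one, Λ.corner_succ]
  have := Dir.crossed_faces (Λ.corner (k.val : ZMod (2 * N))) (Λ.dir (k.val : ZMod (2 * N)))
  rcases this with ⟨h₁, h₂⟩ | ⟨h₁, h₂⟩ <;> simp only [term, h₁, h₂]
  exact or_comm

/-! ### The plaquettes of the gyration -/

/-- The plaquettes whose boundaries are the cycles of `Γ`. -/
def IsGyrationPlaquette (p : ℤ × ℤ) : Prop :=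
  Even ((p.1 + p.2) - ((Λ.corner 1).1 + (Λ.corner 1).2))

theorem isGyrationPlaquette_lowFace (e : LatticeEdge) :
    Λ.IsGyrationPlaquette e.lowFace ↔ ¬ Λ.IsGyrationPlaquette e.highFace := by
  cases e <;>
    simp only [IsGyrationPlaquette, LatticeEdge.lowFace, LatticeEdge.highFace, Int.even_iff] <;>
    omega

open Classical in
/-- The plaquette of the gyration around the edge `e`: it says in which cycle of `Γ` the edge
lies. -/
noncomputable def face (e : LatticeEdge) : ℤ × ℤ :=
  if Λ.IsGyrationPlaquette e.highFace then e.highFace else e.lowFace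

theorem face_eq_iff {e : LatticeEdge} {p : ℤ × ℤ} :
    Λ.face e = p ↔ Λ.IsGyrationPlaquette p ∧ ∃ d : Dir, d.crossed p = e := by
  have h := Λ.isGyrationPlaquette_lowFace e
  rw [Dir.exists_crossed_eq_iff, face]
  split_ifs <;> grind

theorem isGyrationPlaquette_face (e : LatticeEdge) : Λ.IsGyrationPlaquette (Λ.face e) :=
  (Λ.face_eq_iff.1 rfl).1

theorem exists_crossed_face (e : LatticeEdge) : ∃ d : Dir, d.crossed (Λ.face e) = e :=
  (Λ.face_eq_iff.1 rfl).2

variable {Λ} in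
theorem IsGyrationPlaquette.face_crossed {p : ℤ × ℤ} (hp : Λ.IsGyrationPlaquette p) (d : Dir) :
    Λ.face (d.crossed p) = p :=
  Λ.face_eq_iff.2 ⟨hp, d, rfl⟩

/-- The plaquette between the two terminations of a pair. -/
def pairCorner (i : Fin N) : ℤ × ℤ := Λ.corner ((2 * i.val + 1 : ℕ) : ZMod (2 * N))

theorem pairCorner_injective : Function.Injective Λ.pairCorner := fun i j h => by
  have := natCast_zmod_injOn (Set.mem_Iio.2 (by omega)) (Set.mem_Iio.2 (by omega))
    (Λ.corner_injective h)
  omega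

theorem isGyrationPlaquette_corner (i : ℕ) :
    Λ.IsGyrationPlaquette (Λ.corner ((2 * i + 1 : ℕ) : ZMod (2 * N))) := by
  induction i with
  | zero => simp [IsGyrationPlaquette]
  | succ i ih =>
    have vec_odd (d : Dir) : (d.vec.1 + d.vec.2) % 2 = 1 := by cases d <;> simp [Dir.vec]
    have h₁ := vec_odd (Λ.dir ((2 * i + 1 : ℕ) : ZMod (2 * N)))
    have h₂ := vec_odd (Λ.dir (((2 * i + 1 : ℕ) : ZMod (2 * N)) + 1))
    have hcast : ((2 * (i + 1) + 1 : ℕ) : ZMod (2 * N)) = (2 * i + 1 : ℕ) + 1 + 1 := by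
      push_cast
      ring
    rw [hcast, Λ.corner_succ, Λ.corner_succ]
    simp only [IsGyrationPlaquette, Int.even_iff, Prod.fst_add, Prod.snd_add] at ih ⊢
    omega

theorem face_term (k : Fin (2 * N)) : Λ.face (Λ.term k).val = Λ.pairCorner (pairOf k) := by
  refine Λ.face_eq_iff.2 ⟨Λ.isGyrationPlaquette_corner _, Λ.faces_term.2 ?_⟩
  rcases eq_fstTerm_or_sndTerm k with h | h
  · exact .inr (by rw [pairCorner, h, pairOf_fstTerm]; rfl)
  · exact .inl (by rw [pairCorner, h, pairOf_sndTerm]; rfl)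

theorem pairOf_eq_of_face_eq {k l : Fin (2 * N)}
    (h : Λ.face (Λ.term k).val = Λ.face (Λ.term l).val) : pairOf k = pairOf l := by
  rw [face_term, face_term] at h
  exact Λ.pairCorner_injective h

/-! ### The gyration -/

variable {Λ}

/-- The colour of a lattice edge in a configuration, extended by white outside the domain. -/
def color (φ : Λ.Edge → Bool) (e : LatticeEdge) : Bool :=
  if h : e ∈ Λ.verts.biUnion edgesAt then φ ⟨e, h⟩ else false

theorem color_coe (φ : Λ.Edge → Bool) (e : Λ.Edge) : color φ e.val = φ e := by
  simp only [color, e.property, dif_pos]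

theorem mem_edges_of_mem_verts {v : ℤ × ℤ} (hv : v ∈ Λ.verts) {e : LatticeEdge}
    (he : e ∈ edgesAt v) : e ∈ Λ.verts.biUnion edgesAt :=
  Finset.mem_biUnion.2 ⟨v, hv, he⟩

theorem card_filter_edges_eq (φ : Λ.Edge → Bool) {v : ℤ × ℤ} (hv : v ∈ Λ.verts) (c : Bool) :
    (Finset.univ.filter fun e : Λ.Edge => e.val ∈ edgesAt v ∧ φ e = c).card =
      ((edgesAt v).filter fun e => color φ e = c).card := by
  rw [← Finset.card_map (Function.Embedding.subtype _)]
  congr 1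
  ext e
  simp only [Finset.mem_map, Finset.mem_filter, Finset.mem_univ, true_and]
  constructor
  · rintro ⟨e, ⟨he, hc⟩, rfl⟩
    exact ⟨he, (color_coe φ e).trans hc⟩
  · rintro ⟨he, hc⟩
    exact ⟨⟨e, mem_edges_of_mem_verts hv he⟩, ⟨he, (color_coe φ _).symm.trans hc⟩, rfl⟩

theorem isFPL_iff {φ : Λ.Edge → Bool} :
    Λ.IsFPL φ ↔ ∀ v ∈ Λ.verts, ∑ e ∈ edgesAt v, (color φ e).toNat = 2 := by
  refine forall₂_congr fun v hv => ?_
  have hblack : ∑ e ∈ edgesAt v, (color φ e).toNat =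
      ((edgesAt v).filter fun e => color φ e = true).card := by
    rw [Finset.card_filter]
    exact Finset.sum_congr rfl fun e _ => by cases color φ e <;> rfl
  have hsum := Finset.card_filter_add_card_filter_not (s := edgesAt v) fun e => color φ e = true
  simp only [card_edgesAt, Bool.not_eq_true] at hsum
  simp only [card_filter_edges_eq φ hv, Bool.forall_bool, hblack]
  omega

open Classical in
theorem exists_sum_edgesAt_eq (v : ℤ × ℤ) : ∃ (p q : ℤ × ℤ) (c d : Dir),
    Λ.IsGyrationPlaquette p ∧ Λ.IsGyrationPlaquette q ∧ c.left p = v ∧ d.left q = v ∧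
      ∀ f : LatticeEdge → ℕ, ∑ e ∈ edgesAt v, f e =
        (f (c.crossed p) + f (c.next.crossed p)) + (f (d.crossed q) + f (d.next.crossed q)) := by
  obtain ⟨x, y⟩ := v
  by_cases h : Λ.IsGyrationPlaquette (x, y)
  · refine ⟨(x, y), (x - 1, y - 1), .west, .east, h, ?_, rfl, by simp [Dir.left], fun f => ?_⟩
    · simp only [IsGyrationPlaquette, Int.even_iff] at h ⊢
      omega
    · simp only [sum_edgesAt, Dir.crossed, Dir.next, sub_add_cancel]
      ring
  · refine ⟨(x - 1, y), (x, y - 1), .south, .north, ?_, ?_, by simp [Dir.left], by simp [Dir.left],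
      fun f => ?_⟩
    · simp only [IsGyrationPlaquette, Int.even_iff] at h ⊢
      omega
    · simp only [IsGyrationPlaquette, Int.even_iff] at h ⊢
      omega
    · simp only [sum_edgesAt, Dir.crossed, Dir.next, sub_add_cancel]
      ring

/-- A plaquette is alternating in a configuration if its four corners belong to the region and the
colours of its four edges alternate. The gyration leaves these plaquettes invariant. -/
def Alternating (φ : Λ.Edge → Bool) (p : ℤ × ℤ) : Prop :=
  ∀ d : Dir, d.left p ∈ Λ.verts ∧ color φ (d.crossed p) ≠ color φ (d.next.crossed p)

open Classical in
/-- The gyration: it inverts the colours of the edges around all the non-alternating plaquettes of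
the gyration. (Inverting an alternating plaquette amounts to rotating it, so that this is the usual
gyration followed by the inversion of all colours.) -/
noncomputable def gyrate (φ : Λ.Edge → Bool) (e : Λ.Edge) : Bool :=
  if Alternating φ (Λ.face e.val) then φ e else !φ e

theorem gyrate_of_alternating {φ : Λ.Edge → Bool} {e : Λ.Edge} (h : Alternating φ (Λ.face e.val)) :
    gyrate φ e = φ e :=
  if_pos h

theorem gyrate_of_not_alternating {φ : Λ.Edge → Bool} {e : Λ.Edge}
    (h : ¬ Alternating φ (Λ.face e.val)) : gyrate φ e = !φ e :=
  if_neg h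

open Classical in
theorem color_gyrate_crossed (φ : Λ.Edge → Bool) {p : ℤ × ℤ} (hp : Λ.IsGyrationPlaquette p)
    {d : Dir} (hd : d.crossed p ∈ Λ.verts.biUnion edgesAt) :
    color (gyrate φ) (d.crossed p) =
      if Alternating φ p then color φ (d.crossed p) else !color φ (d.crossed p) := by
  simp only [color, dif_pos hd, gyrate, hp.face_crossed]

theorem crossed_mem_edges_of_left {p : ℤ × ℤ} {d : Dir} (h : d.left p ∈ Λ.verts) :
    d.crossed p ∈ Λ.verts.biUnion edgesAt ∧ d.next.crossed p ∈ Λ.verts.biUnion edgesAt := by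
  simp only [crossed_mem_edges_iff, Dir.next_right, h, true_or, or_true, and_self]

theorem alternating_gyrate_iff {φ : Λ.Edge → Bool} {p : ℤ × ℤ} (hp : Λ.IsGyrationPlaquette p) :
    Alternating (gyrate φ) p ↔ Alternating φ p := by
  refine forall_congr' fun d => and_congr_right fun hv => ?_
  obtain ⟨h, h'⟩ := crossed_mem_edges_of_left hv
  rw [color_gyrate_crossed φ hp h, color_gyrate_crossed φ hp h']
  split_ifs <;> simp

theorem gyrate_gyrate (φ : Λ.Edge → Bool) : gyrate (gyrate φ) = φ := by
  funext e
  by_cases h : Alternating φ (Λ.face e.val) <;>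
    simp [gyrate, alternating_gyrate_iff (Λ.isGyrationPlaquette_face e.val), h]

/-- In an alternating plaquette the two sides at a corner have one edge of each colour, before and
after the gyration; in the other plaquettes each of the two sides changes its colour. -/
theorem color_add_color_gyrate (φ : Λ.Edge → Bool) {p : ℤ × ℤ} (hp : Λ.IsGyrationPlaquette p)
    {d : Dir} (hd : d.left p ∈ Λ.verts) :
    ((color φ (d.crossed p)).toNat + (color φ (d.next.crossed p)).toNat) +
      ((color (gyrate φ) (d.crossed p)).toNat + (color (gyrate φ) (d.next.crossed p)).toNat) =
        2 := by
  obtain ⟨h, h'⟩ := crossed_mem_edges_of_left hd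
  rw [color_gyrate_crossed φ hp h, color_gyrate_crossed φ hp h']
  split_ifs with halt
  · have hne := (halt d).2
    revert hne
    cases color φ (d.crossed p) <;> cases color φ (d.next.crossed p) <;> simp
  · cases color φ (d.crossed p) <;> cases color φ (d.next.crossed p) <;> rfl

theorem IsFPL.isFPL_gyrate {φ : Λ.Edge → Bool} (h : Λ.IsFPL φ) : Λ.IsFPL (gyrate φ) := by
  rw [isFPL_iff] at h ⊢
  intro v hv
  obtain ⟨p, q, c, d, hp, hq, hcv, hdv, hsum⟩ := exists_sum_edgesAt_eq (Λ := Λ) v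
  have hφ := h v hv
  rw [hsum] at hφ ⊢
  have hpsum := color_add_color_gyrate φ hp (hcv ▸ hv)
  have hqsum := color_add_color_gyrate φ hq (hdv ▸ hv)
  omega

theorem Alternating.not_isBoundary {φ : Λ.Edge → Bool} {e : LatticeEdge}
    (h : Alternating φ (Λ.face e)) : ¬ Λ.IsBoundary e := by
  obtain ⟨d, hd⟩ := Λ.exists_crossed_face e
  rw [← hd, isBoundary_crossed_iff, ← Dir.next_next_next_next d, Dir.next_right,
    Dir.next_next_next_next]
  simp only [(h _).1, not_true, iff_self, not_false_eq_true]

theorem gyrate_term (φ : Λ.Edge → Bool) (k : Fin (2 * N)) :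
    gyrate φ (Λ.term k) = !φ (Λ.term k) :=
  gyrate_of_not_alternating fun h => h.not_isBoundary (Λ.isBoundary_term k)

theorem complBC_complBC (τ : Fin (2 * N) → Bool) : complBC (complBC τ) = τ :=
  funext fun k => Bool.not_not (τ k)

theorem IsFPLWith.isFPLWith_gyrate {τ : Fin (2 * N) → Bool} {φ : Λ.Edge → Bool}
    (h : Λ.IsFPLWith τ φ) : Λ.IsFPLWith (complBC τ) (gyrate φ) :=
  ⟨h.1.isFPL_gyrate, fun k => by rw [gyrate_term, h.2, complBC]⟩

theorem isFPLWith_gyrate_iff {τ : Fin (2 * N) → Bool} {φ : Λ.Edge → Bool} :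
    Λ.IsFPLWith (complBC τ) (gyrate φ) ↔ Λ.IsFPLWith τ φ :=
  ⟨fun h => by simpa only [complBC_complBC, gyrate_gyrate] using h.isFPLWith_gyrate,
    IsFPLWith.isFPLWith_gyrate⟩

variable (Λ) in
/-- The gyration as a bijection between the configurations with boundary condition `τ` and those
with the complementary one. -/
noncomputable def gyrateEquiv (τ : Fin (2 * N) → Bool) :
    {φ : Λ.Edge → Bool // Λ.IsFPLWith τ φ} ≃ {φ : Λ.Edge → Bool // Λ.IsFPLWith (complBC τ) φ} :=
  (Function.Involutive.toPerm gyrate gyrate_gyrate).subtypeEquiv fun _ => isFPLWith_gyrate_iff.symm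

/-! ### Paths in the glued graph -/

instance (φ : Λ.Edge → Bool) : Std.Symm (Λ.Consecutive φ) where
  symm _ _ := fun ⟨hφ, v, hv, he, hf⟩ => ⟨hφ.symm, v, hv, hf, he⟩

/-- The paths and cycles of a configuration, as an equivalence relation on the edges. -/
def pathSetoid (φ : Λ.Edge → Bool) : Setoid Λ.Edge where
  r := Λ.SamePath φ
  iseqv := ⟨fun _ => .refl, Relation.ReflTransGen.stdSymm.symm _ _, .trans⟩

theorem pathSetoid_le_iff {φ : Λ.Edge → Bool} {T : Setoid Λ.Edge} :
    pathSetoid φ ≤ T ↔ ∀ e f, Λ.Consecutive φ e f → T e f := by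
  refine ⟨fun h e f hef => h (.single hef), fun h e f hef => ?_⟩
  change Relation.ReflTransGen _ e f at hef
  induction hef with
  | refl => exact T.refl e
  | tail _ hcons ih => exact T.trans ih (h _ _ hcons)

/-- The connectivity in the glued graph: the two terminations of every (black, black) pair are
joined to each other. -/
def gluedPathSetoid (τ : Fin (2 * N) → Bool) (φ : Λ.Edge → Bool) : Setoid Λ.Edge :=
  pathSetoid φ ⊔ gluing τ Λ.term

theorem Consecutive.gluedPath {τ : Fin (2 * N) → Bool} {φ : Λ.Edge → Bool} {e f : Λ.Edge}
    (h : Λ.Consecutive φ e f) : gluedPathSetoid τ φ e f :=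
  (le_sup_left : pathSetoid φ ≤ gluedPathSetoid τ φ) (.single h)

theorem ValidTriplet.validTriplet_complBC {τ : Fin (2 * N) → Bool} (h : Λ.ValidTriplet τ) :
    Λ.ValidTriplet (complBC τ) := by
  have hmixed : Λ.mixedVertices (complBC τ) = Λ.mixedVertices τ := by
    simp [mixedVertices, complBC]
  exact ⟨h.1, hmixed ▸ h.2⟩

theorem card_cycleAt {p : ℤ × ℤ} (h : ∀ d : Dir, d.crossed p ∈ Λ.verts.biUnion edgesAt) :
    (Λ.cycleAt p).card = 4 := by
  have hmap : (Λ.cycleAt p).map (Function.Embedding.subtype _) = plaquetteEdges p := by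
    ext e
    simp only [cycleAt, Finset.mem_map, Finset.mem_filter, Finset.mem_univ, true_and,
      Function.Embedding.subtype_apply]
    refine ⟨fun ⟨_, he', heq⟩ => heq ▸ he', fun he => ?_⟩
    obtain ⟨d, rfl⟩ := Dir.mem_plaquetteEdges_iff.1 he
    exact ⟨⟨_, h d⟩, he, rfl⟩
  rw [← Finset.card_map, hmap]
  simp [plaquetteEdges]

theorem color_eq_true_iff {φ : Λ.Edge → Bool} {e : LatticeEdge} :
    color φ e = true ↔ ∃ h : e ∈ Λ.verts.biUnion edgesAt, φ ⟨e, h⟩ = true := by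
  by_cases h : e ∈ Λ.verts.biUnion edgesAt <;> simp [color, h]

section NonAlternating

variable {τ : Fin (2 * N) → Bool} {φ : Λ.Edge → Bool}

theorem ValidTriplet.exists_crossed_notMem (hvalid : Λ.ValidTriplet τ) {k l : Fin (2 * N)}
    (hkl : pairOf k = pairOf l) (hτ : τ k ≠ τ l) :
    ∃ d : Dir, d.crossed (Λ.face (Λ.term k).val) ∉ Λ.verts.biUnion edgesAt := by
  by_contra! hmem
  have hk : Λ.term k ∈ Λ.cycleAt (Λ.face (Λ.term k).val) :=
    Finset.mem_filter.2 ⟨Finset.mem_univ _,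
      Dir.mem_plaquetteEdges_iff.2 (Λ.exists_crossed_face _)⟩
  have hmixed : τ (fstTerm (pairOf k)) ≠ τ (sndTerm (pairOf k)) := by
    have := eq_fstTerm_or_sndTerm k
    have := eq_fstTerm_or_sndTerm l
    grind
  have hinc : Λ.GluedIncident (Λ.term k) (.inr (pairOf k)) :=
    (eq_fstTerm_or_sndTerm k).imp (congrArg Λ.term) (congrArg Λ.term)
  have hcard := hvalid.2 _ ⟨⟨_, hk⟩, _, Λ.isGyrationPlaquette_face _, rfl⟩ _ ⟨_, rfl, hmixed⟩
    ⟨_, hk, hinc⟩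
  rw [card_cycleAt hmem] at hcard
  omega

variable (hτ : ∀ k, φ (Λ.term k) = τ k)
include hτ

theorem gluedPath_of_isBoundary {e f : Λ.Edge} (he : Λ.IsBoundary e.val)
    (hf : Λ.IsBoundary f.val) (hface : Λ.face e.val = Λ.face f.val) (hφe : φ e = true)
    (hφf : φ f = true) : gluedPathSetoid τ φ e f := by
  obtain ⟨k, rfl⟩ := Λ.exists_term_eq he
  obtain ⟨l, rfl⟩ := Λ.exists_term_eq hf
  rw [hτ] at hφe hφf
  exact (le_sup_right : gluing τ Λ.term ≤ gluedPathSetoid τ φ)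
    (gluing_apply _ (Λ.pairOf_eq_of_face_eq hface) hφe hφf)

theorem gluedPath_of_next {e f : Λ.Edge} {p : ℤ × ℤ} (hp : Λ.IsGyrationPlaquette p) {d : Dir}
    (he : d.crossed p = e.val) (hf : d.next.crossed p = f.val) (hφe : φ e = true)
    (hφf : φ f = true) : gluedPathSetoid τ φ e f := by
  by_cases hv : d.left p ∈ Λ.verts
  · refine Consecutive.gluedPath ⟨hφe.trans hφf.symm, d.left p, hv, ?_, ?_⟩
    · exact he ▸ Dir.crossed_mem_edgesAt.2 (.inl rfl)
    · exact hf ▸ Dir.crossed_mem_edgesAt.2 (.inr (Dir.next_right p d).symm)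
  · have he' := Λ.crossed_mem_edges_iff.1 (he ▸ e.property)
    have hf' := Λ.crossed_mem_edges_iff.1 (hf ▸ f.property)
    rw [Dir.next_right] at hf'
    refine gluedPath_of_isBoundary hτ (he ▸ Λ.isBoundary_crossed_iff.2 ?_)
      (hf ▸ Λ.isBoundary_crossed_iff.2 ?_) ?_ hφe hφf
    · tauto
    · rw [Dir.next_right]
      tauto
    · rw [← he, ← hf, hp.face_crossed, hp.face_crossed]

theorem ValidTriplet.alternating_of_color_ne (hvalid : Λ.ValidTriplet τ) {p : ℤ × ℤ}
    (hp : Λ.IsGyrationPlaquette p) (hmem : ∀ d : Dir, d.crossed p ∈ Λ.verts.biUnion edgesAt)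
    (hne : ∀ d : Dir, color φ (d.crossed p) ≠ color φ (d.next.crossed p)) :
    Alternating φ p := by
  refine fun d => ⟨?_, hne d⟩
  by_contra hv
  have hd := Λ.crossed_mem_edges_iff.1 (hmem d)
  have hn := Λ.crossed_mem_edges_iff.1 (hmem d.next)
  obtain ⟨k, hk⟩ := Λ.exists_term_eq (e := ⟨_, hmem d⟩) (Λ.isBoundary_crossed_iff.2 (by tauto))
  obtain ⟨l, hl⟩ := Λ.exists_term_eq (e := ⟨_, hmem d.next⟩)
    (Λ.isBoundary_crossed_iff.2 (by rw [Dir.next_right] at hn ⊢; tauto))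
  have hfk : Λ.face (Λ.term k).val = p := by rw [hk, hp.face_crossed]
  have hfl : Λ.face (Λ.term l).val = p := by rw [hl, hp.face_crossed]
  obtain ⟨c, hc⟩ := hvalid.exists_crossed_notMem
    (Λ.pairOf_eq_of_face_eq (hfk.trans hfl.symm)) (by
      rw [← hτ, ← hτ, ← color_coe φ, ← color_coe φ, hk, hl]
      exact hne d)
  exact hc (hfk ▸ hmem c)

theorem ValidTriplet.isBoundary_of_opposite (hvalid : Λ.ValidTriplet τ) {p : ℤ × ℤ}
    (hp : Λ.IsGyrationPlaquette p) (halt : ¬ Alternating φ p) {d : Dir}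
    (h₀ : color φ (d.crossed p) = true) (h₁ : color φ (d.next.crossed p) = false)
    (h₂ : color φ (d.next.next.crossed p) = true)
    (h₃ : color φ (d.next.next.next.crossed p) = false) : Λ.IsBoundary (d.crossed p) := by
  by_contra hbd
  have hmem₀ := (color_eq_true_iff.1 h₀).1
  have hmem₂ := (color_eq_true_iff.1 h₂).1
  have hcorner : d.next.next.next.left p = d.right p := by
    rw [← Dir.next_right, Dir.next_next_next_next]
  rw [isBoundary_crossed_iff, not_not] at hbd
  have hboth := Λ.crossed_mem_edges_iff.1 hmem₀
  have hmem₁ : d.next.crossed p ∈ Λ.verts.biUnion edgesAt := by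
    rw [crossed_mem_edges_iff, Dir.next_right]
    tauto
  have hmem₃ : d.next.next.next.crossed p ∈ Λ.verts.biUnion edgesAt := by
    rw [crossed_mem_edges_iff, hcorner]
    tauto
  refine halt (hvalid.alternating_of_color_ne hτ hp ?_ ?_) <;> intro c <;>
    rcases Dir.eq_or_eq_next c d with rfl | rfl | rfl | rfl
  all_goals simp_all only [Dir.next_next_next_next, ne_eq, Bool.true_eq_false, Bool.false_eq_true,
    not_false_eq_true]

theorem gluedPath_of_opposite (hvalid : Λ.ValidTriplet τ) {e f : Λ.Edge} {p : ℤ × ℤ}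
    (hp : Λ.IsGyrationPlaquette p) (halt : ¬ Alternating φ p) {d : Dir} (he : d.crossed p = e.val)
    (hf : d.next.next.crossed p = f.val) (hφe : φ e = true) (hφf : φ f = true) :
    gluedPathSetoid τ φ e f := by
  have h₀ : color φ (d.crossed p) = true := by rwa [he, color_coe]
  have h₂ : color φ (d.next.next.crossed p) = true := by rwa [hf, color_coe]
  cases h₁ : color φ (d.next.crossed p) with
  | true =>
    obtain ⟨hg, hφg⟩ := color_eq_true_iff.1 h₁
    exact Setoid.trans' _ (gluedPath_of_next hτ hp he (f := ⟨_, hg⟩) rfl hφe hφg)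
      (gluedPath_of_next hτ hp rfl hf hφg hφf)
  | false =>
    cases h₃ : color φ (d.next.next.next.crossed p) with
    | true =>
      obtain ⟨hg, hφg⟩ := color_eq_true_iff.1 h₃
      refine Setoid.symm' _ (Setoid.trans' _
        (gluedPath_of_next hτ hp hf (f := ⟨_, hg⟩) rfl hφf hφg)
        (gluedPath_of_next hτ hp rfl ?_ hφg hφe))
      rwa [Dir.next_next_next_next]
    | false =>
      refine gluedPath_of_isBoundary hτ (he ▸ hvalid.isBoundary_of_opposite hτ hp halt h₀ h₁ h₂ h₃)
        (hf ▸ hvalid.isBoundary_of_opposite hτ hp halt h₂ h₃ ?_ ?_) ?_ hφe hφf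
      · rwa [Dir.next_next_next_next]
      · rwa [Dir.next_next_next_next]
      · rw [← he, ← hf, hp.face_crossed, hp.face_crossed]

/-- In the critical case of two opposite black sides separated by white ones, validity forces both
of them to be terminations. -/
theorem gluedPath_of_face_eq (hvalid : Λ.ValidTriplet τ) {e f : Λ.Edge}
    (hface : Λ.face e.val = Λ.face f.val) (halt : ¬ Alternating φ (Λ.face e.val))
    (hφe : φ e = true) (hφf : φ f = true) : gluedPathSetoid τ φ e f := by
  obtain ⟨d, hd⟩ := Λ.exists_crossed_face e.val
  obtain ⟨c, hc⟩ := Λ.exists_crossed_face f.val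
  have hp := Λ.isGyrationPlaquette_face e.val
  rw [← hface] at hc
  rcases Dir.eq_or_eq_next c d with rfl | rfl | rfl | rfl
  · rw [Subtype.ext (hd.symm.trans hc)]
  · exact gluedPath_of_next hτ hp hd hc hφe hφf
  · exact gluedPath_of_opposite hτ hvalid hp halt hd hc hφe hφf
  · refine Setoid.symm' _ (gluedPath_of_next hτ hp hc ?_ hφf hφe)
    rwa [Dir.next_next_next_next]

end NonAlternating

/-! ### The gyration preserves the connectivity in the glued graph -/

variable {τ : Fin (2 * N) → Bool} {φ : Λ.Edge → Bool}

/-- The black edges of the gyrated configuration that take the place of the black edge `e`: the edge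
`e` itself if its plaquette is alternating, and else all the formerly white sides of the
plaquette. -/
def replacements (φ : Λ.Edge → Bool) (e : Λ.Edge) : Set Λ.Edge :=
  {f | φ e = true ∧ gyrate φ f = true ∧ Λ.face f.val = Λ.face e.val ∧
    (Alternating φ (Λ.face e.val) → f = e)}

theorem replacements_eq_of_not_alternating {e f : Λ.Edge} (hφ : φ e = φ f)
    (hface : Λ.face e.val = Λ.face f.val) (halt : ¬ Alternating φ (Λ.face e.val)) :
    replacements φ e = replacements φ f := by
  ext g
  simp only [replacements, Set.mem_ofPred_eq, hφ, ← hface, halt, false_imp_iff]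

theorem IsFPLWith.gluedPath_of_mem_replacements (hφ : Λ.IsFPLWith τ φ) (hvalid : Λ.ValidTriplet τ)
    {e f g : Λ.Edge} (hf : f ∈ replacements φ e) (hg : g ∈ replacements φ e) :
    gluedPathSetoid (complBC τ) (gyrate φ) f g := by
  obtain ⟨-, hφf, hface_f, hf⟩ := hf
  obtain ⟨-, hφg, hface_g, hg⟩ := hg
  by_cases halt : Alternating φ (Λ.face e.val)
  · rw [hf halt, hg halt]
  · refine gluedPath_of_face_eq hφ.isFPLWith_gyrate.2 hvalid.validTriplet_complBC
      (hface_f.trans hface_g.symm) ?_ hφf hφg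
    rwa [alternating_gyrate_iff (Λ.isGyrationPlaquette_face _), hface_f]

/-- The edges of the gyrated configuration connected in the glued graph to a replacement of `e`. -/
def attached (τ : Fin (2 * N) → Bool) (φ : Λ.Edge → Bool) (e : Λ.Edge) : Set Λ.Edge :=
  {x | ∃ f ∈ replacements φ e, gluedPathSetoid (complBC τ) (gyrate φ) f x}

theorem IsFPLWith.mem_attached_iff (hφ : Λ.IsFPLWith τ φ) (hvalid : Λ.ValidTriplet τ)
    {e f x : Λ.Edge} (hf : f ∈ replacements φ e) :
    x ∈ attached τ φ e ↔ gluedPathSetoid (complBC τ) (gyrate φ) f x :=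
  ⟨fun ⟨_, hg, hgx⟩ => Setoid.trans' _ (hφ.gluedPath_of_mem_replacements hvalid hf hg) hgx,
    fun h => ⟨f, hf, h⟩⟩

theorem exists_corner_of_face_eq {e f : Λ.Edge} {v : ℤ × ℤ} (he : e.val ∈ edgesAt v)
    (hf : f.val ∈ edgesAt v) (hface : Λ.face e.val = Λ.face f.val) (hne : e ≠ f) :
    ∃ d : Dir, (d.crossed (Λ.face e.val) = e.val ∧ d.next.crossed (Λ.face e.val) = f.val) ∨
      (d.crossed (Λ.face e.val) = f.val ∧ d.next.crossed (Λ.face e.val) = e.val) := by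
  obtain ⟨c, hc⟩ := Λ.exists_crossed_face e.val
  obtain ⟨d, hd⟩ := Λ.exists_crossed_face f.val
  rw [← hface] at hd
  obtain ⟨b, hb, hcb⟩ := Dir.exists_left_eq (hc.symm ▸ he)
  obtain ⟨b', hb', hdb⟩ := Dir.exists_left_eq (hd.symm ▸ hf)
  obtain rfl := Dir.left_injective _ (hb.trans hb'.symm)
  have hcd : c ≠ d := fun h => hne (Subtype.ext (by rw [← hc, ← hd, h]))
  exact ⟨b, by grind⟩

theorem not_alternating_of_consecutive {e f : Λ.Edge} (h : Λ.Consecutive φ e f)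
    (hface : Λ.face e.val = Λ.face f.val) (hne : e ≠ f) : ¬ Alternating φ (Λ.face e.val) := by
  obtain ⟨hφ, v, -, he, hf⟩ := h
  obtain ⟨d, hd⟩ := exists_corner_of_face_eq he hf hface hne
  rw [← color_coe φ, ← color_coe φ] at hφ
  intro halt
  have := (halt d).2
  rcases hd with ⟨hde, hdf⟩ | ⟨hde, hdf⟩ <;> rw [hde, hdf] at this
  exacts [this hφ, this hφ.symm]

theorem IsFPL.eq_or_eq (hφ : Λ.IsFPL φ) {v : ℤ × ℤ} (hv : v ∈ Λ.verts) {e f g : Λ.Edge}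
    (he : e.val ∈ edgesAt v) (hf : f.val ∈ edgesAt v) (hg : g.val ∈ edgesAt v) (hne : e ≠ f)
    (hef : φ e = φ f) (hge : φ g = φ e) : g = e ∨ g = f := by
  by_contra! hg'
  refine (hφ v hv (φ e)).not_gt (Finset.two_lt_card.2 ⟨e, ?_, f, ?_, g, ?_, hne, hg'.1.symm,
    hg'.2.symm⟩) <;> simp_all

/-- At a corner of its plaquette, a black edge is replaced by itself if the plaquette is
alternating, and else by the white side that meets it there. -/
theorem exists_mem_replacements_edgesAt {v : ℤ × ℤ} (hv : v ∈ Λ.verts) {e : Λ.Edge}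
    (he : e.val ∈ edgesAt v) (hφe : φ e = true)
    (honly : ∀ g : Λ.Edge, g.val ∈ edgesAt v → φ g = true → Λ.face g.val = Λ.face e.val → g = e) :
    ∃ f ∈ replacements φ e, f.val ∈ edgesAt v := by
  by_cases halt : Alternating φ (Λ.face e.val)
  · exact ⟨e, ⟨hφe, by rwa [gyrate_of_alternating halt], rfl, fun _ => rfl⟩, he⟩
  have hp := Λ.isGyrationPlaquette_face e.val
  obtain ⟨d, hd⟩ := Λ.exists_crossed_face e.val
  obtain ⟨c, hcv, hdc⟩ := Dir.exists_left_eq (hd.symm ▸ he)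
  obtain ⟨c', hne, hc'⟩ : ∃ c' ≠ d, c' = c ∨ c' = c.next := by
    have : c.next ≠ c := by cases c <;> simp [Dir.next]
    rcases hdc with rfl | rfl
    exacts [⟨_, this, .inr rfl⟩, ⟨_, this.symm, .inl rfl⟩]
  have hmem : c'.crossed (Λ.face e.val) ∈ edgesAt v := by
    rw [Dir.crossed_mem_edgesAt]
    rcases hc' with rfl | rfl
    exacts [.inl hcv.symm, .inr (by rw [Dir.next_right, hcv])]
  let f : Λ.Edge := ⟨_, mem_edges_of_mem_verts hv hmem⟩
  have hface : Λ.face f.val = Λ.face e.val := hp.face_crossed c'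
  have hφf : φ f = false := by
    by_contra hφf
    exact hne (Dir.crossed_injective _ ((congrArg Subtype.val
      (honly f hmem (Bool.eq_true_of_not_eq_false hφf) hface)).trans hd.symm))
  refine ⟨f, ⟨hφe, ?_, hface, fun h => absurd h halt⟩, hmem⟩
  rw [gyrate_of_not_alternating (hface ▸ halt), hφf, Bool.not_false]

theorem IsFPLWith.attached_eq_of_consecutive (hφ : Λ.IsFPLWith τ φ) (hvalid : Λ.ValidTriplet τ)
    {e f : Λ.Edge} (h : Λ.Consecutive φ e f) : attached τ φ e = attached τ φ f := by
  by_cases hne : e = f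
  · rw [hne]
  by_cases hface : Λ.face e.val = Λ.face f.val
  · simp only [attached, replacements_eq_of_not_alternating h.1 hface
      (not_alternating_of_consecutive h hface hne)]
  obtain ⟨hef, v, hv, he, hf⟩ := h
  cases hφe : φ e with
  | false => simp [attached, replacements, hφe, ← hef]
  | true =>
    have hφf := hef.symm.trans hφe
    obtain ⟨e', he', hev⟩ := exists_mem_replacements_edgesAt hv he hφe fun g hg hφg hge =>
      (hφ.1.eq_or_eq hv he hf hg hne hef (hφg.trans hφe.symm)).resolve_right
        fun h => hface (h ▸ hge).symm
    obtain ⟨f', hf', hfv⟩ := exists_mem_replacements_edgesAt hv hf hφf fun g hg hφg hgf =>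
      (hφ.1.eq_or_eq hv he hf hg hne hef (hφg.trans hφe.symm)).resolve_left
        fun h => hface (h ▸ hgf)
    have hlink : gluedPathSetoid (complBC τ) (gyrate φ) e' f' :=
      Consecutive.gluedPath ⟨he'.2.1.trans hf'.2.1.symm, v, hv, hev, hfv⟩
    ext x
    rw [hφ.mem_attached_iff hvalid he', hφ.mem_attached_iff hvalid hf']
    exact ⟨Setoid.trans' _ (Setoid.symm' _ hlink), Setoid.trans' _ hlink⟩

theorem IsFPLWith.gluedPathSetoid_le_ker_attached (hφ : Λ.IsFPLWith τ φ)
    (hvalid : Λ.ValidTriplet τ) : gluedPathSetoid τ φ ≤ Setoid.ker (attached τ φ) := by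
  refine sup_le (pathSetoid_le_iff.2 fun _ _ => hφ.attached_eq_of_consecutive hvalid)
    (gluing_le_iff.2 fun i hi => ?_)
  have hi' := (mem_bbPairs τ).1 hi
  have hface : Λ.face (Λ.term (fstTerm i)).val = Λ.face (Λ.term (sndTerm i)).val := by
    rw [face_term, face_term, pairOf_fstTerm, pairOf_sndTerm]
  change attached τ φ _ = attached τ φ _
  simp only [attached, replacements_eq_of_not_alternating
    (show φ _ = φ _ by rw [hφ.2, hφ.2, hi'.1, hi'.2]) hface
    fun h => h.not_isBoundary (Λ.isBoundary_term _)]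

theorem IsFPLWith.term_mem_replacements (hφ : Λ.IsFPLWith τ φ) {i : Fin N}
    (hi : i ∈ mixedPairs τ) :
    Λ.term (pairBlack (complBC τ) i) ∈ replacements φ (Λ.term (pairBlack τ i)) := by
  refine ⟨?_, ?_, ?_, fun h => absurd (Λ.isBoundary_term _) h.not_isBoundary⟩
  · exact (hφ.2 _).trans (pairBlack_black hi)
  · exact (hφ.isFPLWith_gyrate.2 _).trans (pairBlack_black ((mixedPairs_complBC τ).symm ▸ hi))
  · rw [face_term, face_term, pairOf_pairBlack, pairOf_pairBlack]

theorem IsFPLWith.gluedPath_gyrate (hφ : Λ.IsFPLWith τ φ) (hvalid : Λ.ValidTriplet τ)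
    {i j : Fin N} (hi : i ∈ mixedPairs τ) (hj : j ∈ mixedPairs τ)
    (h : gluedPathSetoid τ φ (Λ.term (pairBlack τ i)) (Λ.term (pairBlack τ j))) :
    gluedPathSetoid (complBC τ) (gyrate φ) (Λ.term (pairBlack (complBC τ) i))
      (Λ.term (pairBlack (complBC τ) j)) := by
  have hattached : attached τ φ _ = attached τ φ _ := hφ.gluedPathSetoid_le_ker_attached hvalid h
  rw [← hφ.mem_attached_iff hvalid (hφ.term_mem_replacements hi), hattached,
    hφ.mem_attached_iff hvalid (hφ.term_mem_replacements hj)]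

theorem IsFPLWith.gluedPath_gyrate_iff (hφ : Λ.IsFPLWith τ φ) (hvalid : Λ.ValidTriplet τ)
    {i j : Fin N} (hi : i ∈ mixedPairs τ) (hj : j ∈ mixedPairs τ) :
    gluedPathSetoid (complBC τ) (gyrate φ) (Λ.term (pairBlack (complBC τ) i))
      (Λ.term (pairBlack (complBC τ) j)) ↔
      gluedPathSetoid τ φ (Λ.term (pairBlack τ i)) (Λ.term (pairBlack τ j)) := by
  refine ⟨fun h => ?_, hφ.gluedPath_gyrate hvalid hi hj⟩
  rw [← mixedPairs_complBC] at hi hj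
  have := hφ.isFPLWith_gyrate.gluedPath_gyrate hvalid.validTriplet_complBC hi hj h
  rwa [complBC_complBC, gyrate_gyrate] at this

end LatticeDomain

/-! ### The ends of a path -/

section GraphEnds

variable {V : Type*} [Fintype V] {G : SimpleGraph V} [DecidableRel G.Adj] {v : V}

theorem card_degree_eq_one_of_connected (hG : G.Connected) (hdeg : ∀ u, G.degree u ≤ 2)
    (hv : G.degree v = 1) : (Finset.univ.filter fun u => G.degree u = 1).card = 2 := by
  have hV : Nontrivial V := by
    obtain ⟨w, hw⟩ := (G.degree_pos_iff_exists_adj v).1 (hv ▸ one_pos)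
    exact ⟨v, w, hw.ne⟩
  have hpos (u : V) : 0 < G.degree u := hG.preconnected.degree_pos_of_nontrivial u
  have hsum : 2 * Fintype.card V =
      2 * G.edgeFinset.card + (Finset.univ.filter fun u => G.degree u = 1).card := by
    rw [← G.sum_degrees_eq_twice_card_edges, Finset.card_filter, ← Finset.sum_add_distrib,
      mul_comm, ← smul_eq_mul, ← Finset.card_univ, ← Finset.sum_const]
    refine Finset.sum_congr rfl fun u _ => ?_
    have := hdeg u
    have := hpos u
    split_ifs <;> omega
  have hedges : Fintype.card V ≤ G.edgeFinset.card + 1 := by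
    simpa only [Nat.card_eq_fintype_card, SimpleGraph.edgeFinset_card]
      using hG.card_vert_le_card_edgeSet_add_one
  have hend : 0 < (Finset.univ.filter fun u => G.degree u = 1).card :=
    Finset.card_pos.2 ⟨v, Finset.mem_filter.2 ⟨Finset.mem_univ v, hv⟩⟩
  omega

theorem exists_reachable_degree_eq_one_iff (hdeg : ∀ u, G.degree u ≤ 2)
    (hv : G.degree v = 1) :
    ∃ w ≠ v, ∀ u, G.Reachable v u ∧ G.degree u = 1 ↔ u = v ∨ u = w := by
  classical
  let C := G.connectedComponentMk v
  have hdegC (u : C.supp) : (G.induce C.supp).degree u = G.degree u.val :=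
    SimpleGraph.degree_induce_of_neighborSet_subset fun w hw =>
      (SimpleGraph.ConnectedComponent.mem_supp_congr_adj C hw).1 u.property
  have hcard := card_degree_eq_one_of_connected (G := G.induce C.supp) C.connected_toSimpleGraph
    (fun u => hdegC u ▸ hdeg u.val) (v := ⟨v, rfl⟩) (by rw [hdegC, hv])
  obtain ⟨a, b, hab, hends⟩ := Finset.card_eq_two.1 hcard
  have hends' (u : V) : G.Reachable v u ∧ G.degree u = 1 ↔ u = a.val ∨ u = b.val := by
    have hmem (hu : u ∈ C.supp) := Finset.ext_iff.1 hends ⟨u, hu⟩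
    simp only [Finset.mem_filter, Finset.mem_univ, true_and, hdegC, Finset.mem_insert,
      Finset.mem_singleton, Subtype.ext_iff] at hmem
    constructor
    · exact fun ⟨hvu, hu⟩ => (hmem (SimpleGraph.ConnectedComponent.sound hvu.symm)).1 hu
    · intro h
      have hu : u ∈ C.supp := by rcases h with rfl | rfl <;> exact Subtype.property _
      exact ⟨(SimpleGraph.ConnectedComponent.exact hu).symm, (hmem hu).2 h⟩
  have hab' : a.val ≠ b.val := fun h => hab (Subtype.ext h)
  rcases (hends' v).1 ⟨.refl v, hv⟩ with hva | hvb
  · exact ⟨b.val, hva ▸ hab'.symm, hva ▸ hends'⟩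
  · exact ⟨a.val, hvb ▸ hab', fun u => hvb ▸ (hends' u).trans or_comm⟩

end GraphEnds

theorem LatticeEdge.eq_of_mem_edgesAt {e f : LatticeEdge} {v w : ℤ × ℤ} (hvw : v ≠ w)
    (hev : e ∈ edgesAt v) (hew : e ∈ edgesAt w) (hfv : f ∈ edgesAt v) (hfw : f ∈ edgesAt w) :
    e = f := by
  rw [mem_edgesAt] at *
  cases e <;> cases f <;> grind [LatticeEdge.src, LatticeEdge.tgt]

namespace LatticeDomain

variable {N : ℕ} {Λ : LatticeDomain N} {φ : Λ.Edge → Bool}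

theorem SamePath.color_eq {e f : Λ.Edge} (h : Λ.SamePath φ e f) : φ e = φ f := by
  induction h with
  | refl => rfl
  | tail _ hcons ih => exact ih.trans hcons.1

theorem IsFPL.exists_other (hφ : Λ.IsFPL φ) {v : ℤ × ℤ} (hv : v ∈ Λ.verts) {e : Λ.Edge}
    (he : e.val ∈ edgesAt v) :
    ∃ f ≠ e, ∀ g : Λ.Edge, g.val ∈ edgesAt v ∧ φ g = φ e ↔ g = e ∨ g = f := by
  classical
  obtain ⟨a, b, hab, hpair⟩ := Finset.card_eq_two.1 (hφ v hv (φ e))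
  have hmem (g : Λ.Edge) : g.val ∈ edgesAt v ∧ φ g = φ e ↔ g = a ∨ g = b := by
    simpa using Finset.ext_iff.1 hpair g
  rcases (hmem e).1 ⟨he, rfl⟩ with rfl | rfl
  · exact ⟨b, hab.symm, hmem⟩
  · exact ⟨a, hab, fun g => (hmem g).trans or_comm⟩

/-- The graph whose vertices are the edges of the domain, two of them being adjacent if they
follow each other on a path or cycle of the configuration. -/
def pathGraph (φ : Λ.Edge → Bool) : SimpleGraph Λ.Edge :=
  SimpleGraph.fromRel (Λ.Consecutive φ)

theorem pathGraph_adj {e f : Λ.Edge} : (pathGraph φ).Adj e f ↔ e ≠ f ∧ Λ.Consecutive φ e f := by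
  rw [pathGraph, SimpleGraph.fromRel_adj, or_iff_left_of_imp (Std.Symm.symm _ _)]

theorem pathGraph_reachable {e f : Λ.Edge} : (pathGraph φ).Reachable e f ↔ Λ.SamePath φ e f := by
  rw [SimpleGraph.reachable_iff_reflTransGen, SamePath]
  refine ⟨Relation.ReflTransGen.mono (fun a b h => (pathGraph_adj.1 h).2) e f, fun h => ?_⟩
  induction h with
  | refl => exact .refl
  | @tail a b _ hab ih =>
    rcases eq_or_ne a b with rfl | hne
    · exact ih
    · exact ih.tail (pathGraph_adj.2 ⟨hne, hab⟩)

open Classical in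
theorem IsFPL.degree_pathGraph (hφ : Λ.IsFPL φ) (e : Λ.Edge) :
    (pathGraph φ).degree e = (Λ.verts.filter fun v => e.val ∈ edgesAt v).card := by
  have : Nonempty Λ.Edge := ⟨e⟩
  choose! other hne hother using fun v (h : v ∈ Λ.verts ∧ e.val ∈ edgesAt v) =>
    hφ.exists_other h.1 h.2
  have hother_at {v : ℤ × ℤ} (h : v ∈ Λ.verts ∧ e.val ∈ edgesAt v) :=
    (hother v h _).2 (.inr rfl)
  rw [← SimpleGraph.card_neighborFinset_eq_degree]
  refine (Finset.card_nbij other (fun v hv => ?_) (fun v hv w hw hvw => ?_) fun f hf => ?_).symm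
  · rw [SetLike.mem_coe, Finset.mem_filter] at hv
    rw [SetLike.mem_coe, SimpleGraph.mem_neighborFinset, pathGraph_adj]
    exact ⟨(hne v hv).symm, (hother_at hv).2.symm, v, hv.1, hv.2, (hother_at hv).1⟩
  · rw [SetLike.mem_coe, Finset.mem_filter] at hv hw
    by_contra hne_vw
    exact hne v hv (Subtype.ext (LatticeEdge.eq_of_mem_edgesAt hne_vw (hother_at hv).1
      (hvw ▸ (hother_at hw).1) hv.2 hw.2))
  · rw [SetLike.mem_coe, SimpleGraph.mem_neighborFinset, pathGraph_adj] at hf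
    obtain ⟨hef, hcol, v, hv, he, hfv⟩ := hf
    exact ⟨v, Finset.mem_filter.2 ⟨hv, he⟩,
      (((hother v ⟨hv, he⟩ f).1 ⟨hfv, hcol.symm⟩).resolve_left hef.symm).symm⟩

theorem card_endpoints (e : Λ.Edge) :
    (Λ.verts.filter fun v => e.val ∈ edgesAt v).card ≤ 2 ∧
      ((Λ.verts.filter fun v => e.val ∈ edgesAt v).card = 1 ↔ Λ.IsBoundary e.val) := by
  have hends : (Λ.verts.filter fun v => e.val ∈ edgesAt v) =
      ({e.val.src, e.val.tgt} : Finset (ℤ × ℤ)).filter (· ∈ Λ.verts) := by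
    ext v
    simp only [Finset.mem_filter, Finset.mem_insert, Finset.mem_singleton, mem_edgesAt, and_comm,
      eq_comm]
  have hne : e.val.src ≠ e.val.tgt := by
    cases e.val <;> simp [LatticeEdge.src, LatticeEdge.tgt]
  have he := Λ.mem_edges_iff.1 e.property
  rw [hends, Finset.card_filter, Finset.sum_pair hne, IsBoundary]
  split_ifs <;> simp_all

theorem exists_other_end (hφ : Λ.IsFPL φ) (k : Fin (2 * N)) :
    ∃ l ≠ k, ∀ r, Λ.SamePath φ (Λ.term k) (Λ.term r) ↔ r = k ∨ r = l := by
  classical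
  have hdeg (e : Λ.Edge) : (pathGraph φ).degree e ≤ 2 :=
    hφ.degree_pathGraph e ▸ (card_endpoints e).1
  have hend (e : Λ.Edge) : (pathGraph φ).degree e = 1 ↔ Λ.IsBoundary e.val :=
    hφ.degree_pathGraph e ▸ (card_endpoints e).2
  obtain ⟨f, hfk, hf⟩ := exists_reachable_degree_eq_one_iff hdeg ((hend _).2 (Λ.isBoundary_term k))
  obtain ⟨l, rfl⟩ := Λ.exists_term_eq ((hend f).1 ((hf f).2 (.inr rfl)).2)
  refine ⟨l, fun h => hfk (h ▸ rfl), fun r => ?_⟩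
  rw [← pathGraph_reachable, ← Λ.term_injective.eq_iff, ← Λ.term_injective.eq_iff, ← hf, hend]
  exact (and_iff_left (Λ.isBoundary_term r)).symm

end LatticeDomain

/-! ### Planarity -/

theorem exists_antidifference {M : Type*} [AddCommGroup M] (a : ℤ → M) :
    ∃ s : ℤ → M, s 0 = 0 ∧ ∀ x, s (x + 1) = s x + a x := by
  refine ⟨fun x => ∑ i ∈ Finset.Ico 0 x, a i - ∑ i ∈ Finset.Ico x 0, a i, by simp, fun x => ?_⟩
  dsimp only
  rcases le_or_gt 0 x with hx | hx
  · rw [← Finset.insert_Ico_right_eq_Ico_add_one hx, Finset.sum_insert Finset.right_notMem_Ico,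
      Finset.Ico_eq_empty_of_le hx, Finset.Ico_eq_empty_of_le (hx.trans (lt_add_one x).le)]
    abel
  · rw [← Finset.insert_Ico_add_one_left_eq_Ico hx, Finset.sum_insert (by simp),
      Finset.Ico_eq_empty_of_le hx.le, Finset.Ico_eq_empty_of_le (Int.add_one_le_of_lt hx)]
    abel

/-- The coboundary modulo `2` of a function on the plaquettes. -/
def coboundary (g : ℤ × ℤ → ZMod 2) (e : LatticeEdge) : ZMod 2 := g e.lowFace + g e.highFace

theorem coboundary_crossed (g : ℤ × ℤ → ZMod 2) (p : ℤ × ℤ) (d : Dir) :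
    coboundary g (d.crossed p) = g p + g (p + d.vec) := by
  rw [coboundary]
  rcases Dir.crossed_faces p d with ⟨h₁, h₂⟩ | ⟨h₁, h₂⟩ <;> rw [h₁, h₂]
  exact add_comm _ _

theorem sum_coboundary_edgesAt (g : ℤ × ℤ → ZMod 2) (v : ℤ × ℤ) :
    ∑ e ∈ edgesAt v, coboundary g e = 0 := by
  simp only [sum_edgesAt, coboundary, LatticeEdge.lowFace, LatticeEdge.highFace]
  grind

theorem exists_coboundary_eq {χ : LatticeEdge → ZMod 2}
    (hχ : ∀ v, ∑ e ∈ edgesAt v, χ e = 0) : ∃ F, coboundary F = χ := by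
  choose s hs_zero hs using fun y => exists_antidifference fun x => χ (.vert (x + 1) y)
  obtain ⟨t, -, ht⟩ := exists_antidifference fun y => χ (.horiz 0 (y + 1))
  have hhoriz (x y : ℤ) : (s y x + t y) + (s (y + 1) x + t (y + 1)) = χ (.horiz x (y + 1)) := by
    set D : ℤ → ZMod 2 := fun x =>
      (s y x + t y) + (s (y + 1) x + t (y + 1)) + χ (.horiz x (y + 1)) with hD
    have hperiodic : Function.Periodic D 1 := fun x => by
      have := hχ (x + 1, y + 1)
      simp only [sum_edgesAt, add_sub_cancel_right] at this
      simp only [hD, hs]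
      grind
    have hDx := hperiodic.int_mul_eq x
    simp only [hD, Int.cast_id, mul_one, hs_zero, ht] at hDx
    grind
  refine ⟨fun p => s p.2 p.1 + t p.2, funext fun e => ?_⟩
  cases e with
  | vert x y =>
    have := hs y (x - 1)
    rw [sub_add_cancel] at this
    simp only [coboundary, LatticeEdge.lowFace, LatticeEdge.highFace]
    grind
  | horiz x y =>
    have := hhoriz x (y - 1)
    simpa only [coboundary, LatticeEdge.lowFace, LatticeEdge.highFace, sub_add_cancel] using this

theorem lowFace_eq_of_forall_coboundary_eq_zero {F : ℤ × ℤ → ZMod 2} {v : ℤ × ℤ}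
    (h : ∀ e ∈ edgesAt v, coboundary F e = 0) {e f : LatticeEdge} (he : e ∈ edgesAt v)
    (hf : f ∈ edgesAt v) : F e.lowFace = F f.lowFace := by
  obtain ⟨x, y⟩ := v
  simp only [edgesAt, Finset.mem_insert, Finset.mem_singleton, forall_eq_or_imp, forall_eq,
    coboundary, CharTwo.add_eq_zero, LatticeEdge.lowFace, LatticeEdge.highFace] at h he hf
  obtain ⟨h₁, h₂, h₃, -⟩ := h
  rcases he with rfl | rfl | rfl | rfl <;> rcases hf with rfl | rfl | rfl | rfl <;>
    simp only [LatticeEdge.lowFace] <;> grind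

namespace LatticeDomain

variable {N : ℕ} {Λ : LatticeDomain N} {φ : Λ.Edge → Bool}

open Classical in
/-- The indicator function of the path that contains `e`. -/
noncomputable def pathIndicator (φ : Λ.Edge → Bool) (e : Λ.Edge) (f : LatticeEdge) : ZMod 2 :=
  if ∃ f' : Λ.Edge, f'.val = f ∧ Λ.SamePath φ e f' then 1 else 0

open Classical in
theorem pathIndicator_coe {e f : Λ.Edge} :
    pathIndicator φ e f.val = if Λ.SamePath φ e f then 1 else 0 := by
  have : (∃ f' : Λ.Edge, f'.val = f.val ∧ Λ.SamePath φ e f') ↔ Λ.SamePath φ e f :=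
    ⟨fun ⟨_, hf, h⟩ => Subtype.ext hf ▸ h, fun h => ⟨f, rfl, h⟩⟩
  simp only [pathIndicator, this]

theorem sum_pathIndicator (hφ : Λ.IsFPL φ) (e : Λ.Edge) {v : ℤ × ℤ} (hv : v ∈ Λ.verts) :
    ∑ f ∈ edgesAt v, pathIndicator φ e f = 0 := by
  classical
  by_cases hpath : ∃ f : Λ.Edge, f.val ∈ edgesAt v ∧ Λ.SamePath φ e f
  · obtain ⟨f, hf, hef⟩ := hpath
    obtain ⟨f', hne, hother⟩ := hφ.exists_other hv hf
    have hsame (g : Λ.Edge) : g.val ∈ edgesAt v ∧ Λ.SamePath φ e g ↔ g = f ∨ g = f' := by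
      rw [← hother]
      refine and_congr_right fun hg => ⟨fun h => h.color_eq.symm.trans hef.color_eq, fun h => ?_⟩
      exact hef.tail ⟨h.symm, v, hv, hf, hg⟩
    have hfilter : ((edgesAt v).filter fun g => ∃ g' : Λ.Edge, g'.val = g ∧ Λ.SamePath φ e g') =
        {f.val, f'.val} := by
      ext g
      simp only [Finset.mem_filter, Finset.mem_insert, Finset.mem_singleton]
      constructor
      · rintro ⟨hg, g, rfl, heg⟩
        simpa only [Subtype.ext_iff] using (hsame g).1 ⟨hg, heg⟩
      · rintro (rfl | rfl)
        · exact ⟨hf, f, rfl, hef⟩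
        · obtain ⟨hf', hef'⟩ := (hsame f').2 (.inr rfl)
          exact ⟨hf', f', rfl, hef'⟩
    simp only [pathIndicator]
    rw [Finset.sum_boole, hfilter, Finset.card_pair fun h => hne (Subtype.ext h.symm)]
    rfl
  · refine Finset.sum_eq_zero fun f hf => if_neg ?_
    rintro ⟨f, rfl, hef⟩
    exact hpath ⟨f, hf, hef⟩

-- Outside the domain `χ` is replaced by the coboundary of `g`, which makes it a cocycle on the
-- whole lattice; the boundary path then never crosses a jump of `F + g`.
theorem exists_coboundary_eq_of_eq_on_terms {χ : LatticeEdge → ZMod 2} {g : ℤ × ℤ → ZMod 2}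
    (hχ : ∀ v ∈ Λ.verts, ∑ e ∈ edgesAt v, χ e = 0)
    (hg : ∀ k, χ (Λ.term k).val = coboundary g (Λ.term k).val) :
    ∃ F, (∀ e : Λ.Edge, coboundary F e.val = χ e.val) ∧
      ∀ r : ℕ, F (Λ.corner r) + g (Λ.corner r) = F (Λ.corner 0) + g (Λ.corner 0) := by
  classical
  have hvert {v : ℤ × ℤ} {e : LatticeEdge} (hv : v ∉ Λ.verts) (he : e ∈ edgesAt v) :
      ¬ (e.src ∈ Λ.verts ∧ e.tgt ∈ Λ.verts) := by
    rcases mem_edgesAt.1 he with rfl | rfl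
    exacts [fun h => hv h.1, fun h => hv h.2]
  let χ' e := if e ∈ Λ.verts.biUnion edgesAt then χ e else coboundary g e
  have hχ'_out {e : LatticeEdge} (he : ¬ (e.src ∈ Λ.verts ∧ e.tgt ∈ Λ.verts)) :
      χ' e = coboundary g e := by
    simp only [χ', mem_edges_iff]
    split_ifs with h
    · obtain ⟨k, hk⟩ := Λ.exists_term_eq (e := ⟨e, Λ.mem_edges_iff.2 h⟩)
        (by unfold IsBoundary; tauto)
      simpa only [hk] using hg k
    · rfl
  obtain ⟨F, hF⟩ := exists_coboundary_eq (χ := χ') fun v => by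
    by_cases hv : v ∈ Λ.verts
    · rw [← hχ v hv]
      exact Finset.sum_congr rfl fun e he => if_pos (mem_edges_of_mem_verts hv he)
    · rw [← sum_coboundary_edgesAt g v]
      exact Finset.sum_congr rfl fun e he => hχ'_out (hvert hv he)
  refine ⟨F, fun e => hF ▸ if_pos e.property, fun r => ?_⟩
  induction r with
  | zero => rw [Nat.cast_zero]
  | succ r ih =>
    have hstep := congrFun hF ((Λ.dir r).crossed (Λ.corner r))
    rw [hχ'_out, coboundary_crossed, coboundary_crossed, ← Λ.corner_succ] at hstep
    · rw [Nat.cast_add, Nat.cast_one, ← ih]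
      grind
    · exact fun h => Λ.isBoundary_crossed_iff.2
        (fun h' => Λ.right_notMem _ (h'.1 (Λ.left_mem r))) (iff_of_true h.1 h.2)

theorem lowFace_eq_of_samePath {F : ℤ × ℤ → ZMod 2} {a e f : Λ.Edge}
    (hF : ∀ e : Λ.Edge, coboundary F e.val = pathIndicator φ a e.val) (hcol : φ a = φ e)
    (hae : ¬ Λ.SamePath φ a e) (hef : Λ.SamePath φ e f) :
    F e.val.lowFace = F f.val.lowFace := by
  induction hef with
  | refl => rfl
  | @tail b c heb hbc ih =>
    obtain ⟨-, v, hv, hb, hc⟩ := hbc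
    refine ih.trans (lowFace_eq_of_forall_coboundary_eq_zero (fun d hd => ?_) hb hc)
    rw [hF ⟨d, mem_edges_of_mem_verts hv hd⟩, pathIndicator_coe, if_neg]
    intro had
    have hdb : Λ.Consecutive φ ⟨d, mem_edges_of_mem_verts hv hd⟩ b :=
      ⟨had.color_eq.symm.trans (hcol.trans (SamePath.color_eq heb)), v, hv, hd, hb⟩
    exact hae ((had.tail hdb).trans ((pathSetoid φ).symm heb))

variable (Λ) in
open Classical in
/-- The indicator function of the dual vertices that the boundary path visits between the
terminations `i` and `j`. -/
noncomputable def cornerIndicator (i j : ℕ) (p : ℤ × ℤ) : ZMod 2 :=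
  if ∃ r : ℕ, (i < r ∧ r ≤ j) ∧ Λ.corner r = p then 1 else 0

theorem cornerIndicator_corner {i j r : ℕ} (hj : j < 2 * N) (hr : r ≤ 2 * N) :
    Λ.cornerIndicator i j (Λ.corner r) = if i < r ∧ r ≤ j then 1 else 0 := by
  classical
  have hiff : (∃ s : ℕ, (i < s ∧ s ≤ j) ∧ Λ.corner s = Λ.corner r) ↔ i < r ∧ r ≤ j := by
    refine ⟨fun ⟨s, hs, hsr⟩ => ?_, fun h => ⟨r, h, rfl⟩⟩
    have hcast := Λ.corner_injective hsr
    rcases hr.eq_or_lt with rfl | hr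
    · rw [ZMod.natCast_self, ← Nat.cast_zero] at hcast
      have := natCast_zmod_injOn (Set.mem_Iio.2 (by omega)) (Set.mem_Iio.2 (by omega)) hcast
      omega
    · exact natCast_zmod_injOn (Set.mem_Iio.2 (by omega)) hr hcast ▸ hs
  simp only [cornerIndicator, hiff]

theorem coboundary_term (g : ℤ × ℤ → ZMod 2) (r : Fin (2 * N)) :
    coboundary g (Λ.term r).val = g (Λ.corner r.val) + g (Λ.corner (r.val + 1 : ℕ)) := by
  rw [term, coboundary_crossed, ← Λ.corner_succ, Nat.cast_add, Nat.cast_one]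

theorem coboundary_cornerIndicator_term {i j : Fin (2 * N)} (hij : i < j) (r : Fin (2 * N)) :
    coboundary (Λ.cornerIndicator i j) (Λ.term r).val = if r = i ∨ r = j then 1 else 0 := by
  rw [coboundary_term, cornerIndicator_corner j.isLt r.isLt.le,
    cornerIndicator_corner j.isLt r.isLt]
  split_ifs <;> first | rfl | omega

theorem IsFPL.not_crossing (hφ : Λ.IsFPL φ) {i k j l : Fin (2 * N)} (hik : i < k) (hkj : k < j)
    (hjl : j < l) (hij : Λ.SamePath φ (Λ.term i) (Λ.term j))
    (hkl : Λ.SamePath φ (Λ.term k) (Λ.term l)) : φ (Λ.term i) ≠ φ (Λ.term k) := by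
  classical
  intro hcol
  obtain ⟨j', -, hend⟩ := exists_other_end hφ i
  obtain rfl : j = j' := ((hend j).1 hij).resolve_left (hik.trans hkj).ne'
  obtain ⟨F, hF, hFg⟩ := exists_coboundary_eq_of_eq_on_terms (g := Λ.cornerIndicator i j)
    (fun v hv => sum_pathIndicator hφ (Λ.term i) hv) fun r => by
      simp only [pathIndicator_coe, coboundary_cornerIndicator_term (hik.trans hkj), hend]
  have hlow {r : Fin (2 * N)} (hr : ¬ Λ.SamePath φ (Λ.term i) (Λ.term r)) :
      F (Λ.term r).val.lowFace = F (Λ.corner r.val) := by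
    have hFr := hF (Λ.term r)
    rw [pathIndicator_coe, if_neg hr, coboundary, CharTwo.add_eq_zero] at hFr
    rcases Dir.exists_crossed_eq_iff.1 ⟨Λ.dir r.val, rfl⟩ with h | h
    exacts [congrArg F h, hFr.trans (congrArg F h)]
  have hik' : ¬ Λ.SamePath φ (Λ.term i) (Λ.term k) := by rw [hend]; omega
  have hil' : ¬ Λ.SamePath φ (Λ.term i) (Λ.term l) := by rw [hend]; omega
  have hFkl := lowFace_eq_of_samePath hF hcol hik' hkl
  have hgk := hFg k
  have hgl := hFg l
  rw [cornerIndicator_corner j.isLt k.isLt.le, if_pos ⟨hik, hkj.le⟩] at hgk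
  rw [cornerIndicator_corner j.isLt l.isLt.le, if_neg fun h => hjl.not_ge h.2] at hgl
  rw [hlow hik', hlow hil'] at hFkl
  grind

/-! ### The link pattern of a configuration -/

variable {m n : ℕ} {τ : Fin (2 * N) → Bool}

theorem IsFPLWith.exists_other_black_end (hφ : Λ.IsFPLWith τ φ) (h : (blackTerms τ).card = m)
    (x : Fin m) :
    ∃ y ≠ x, ∀ z, Λ.SamePath φ (Λ.term ((blackTerms τ).orderEmbOfFin h x))
      (Λ.term ((blackTerms τ).orderEmbOfFin h z)) ↔ z = x ∨ z = y := by
  obtain ⟨l, hl, hend⟩ := exists_other_end hφ.1 ((blackTerms τ).orderEmbOfFin h x)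
  have hcolor := ((hend l).2 (.inr rfl)).color_eq
  rw [hφ.2, hφ.2, (mem_blackTerms τ).1 (Finset.orderEmbOfFin_mem _ h x)] at hcolor
  obtain ⟨y, rfl⟩ := exists_orderEmbOfFin_eq τ h hcolor.symm
  exact ⟨y, fun hy => hl (congrArg _ hy), fun z => by
    simp only [hend, EmbeddingLike.apply_eq_iff_eq]⟩

theorem IsFPLWith.exists_represents (hφ : Λ.IsFPLWith τ φ) (h : (blackTerms τ).card = 2 * m) :
    ∃ π : LinkPattern m,
      π.Represents (Λ.term ∘ (blackTerms τ).orderEmbOfFin h) (pathSetoid φ) := by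
  set emb := (blackTerms τ).orderEmbOfFin h
  have hblack (x) : φ (Λ.term (emb x)) = true :=
    (hφ.2 _).trans ((mem_blackTerms τ).1 (Finset.orderEmbOfFin_mem _ h x))
  choose partner hne hend using hφ.exists_other_black_end h
  have hpath (x) : Λ.SamePath φ (Λ.term (emb x)) (Λ.term (emb (partner x))) :=
    (hend x _).2 (.inr rfl)
  have hinvol (x) : partner (partner x) = x :=
    (((hend _ x).1 ((pathSetoid φ).symm (hpath x))).resolve_left (hne x).symm).symm
  have hnoncrossing (x y) : ¬(x < y ∧ y < partner x ∧ partner x < partner y) :=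
    fun ⟨hxy, hyx, hxx⟩ => hφ.1.not_crossing (emb.strictMono hxy) (emb.strictMono hyx)
      (emb.strictMono hxx) (hpath x) (hpath y) ((hblack x).trans (hblack y).symm)
  refine ⟨⟨partner, hinvol, hne, hnoncrossing⟩, fun x y => ⟨?_, fun ⟨hxy, hsame⟩ => ?_⟩⟩
  · rintro rfl
    exact ⟨(hne x).symm, hpath x⟩
  · exact (((hend x y).1 hsame).resolve_left hxy.symm).symm

/-- The link pattern `π(φ)` of a configuration `φ`. -/
noncomputable def linkPattern (h : (blackTerms τ).card = 2 * m)
    (φ : {φ : Λ.Edge → Bool // Λ.IsFPLWith τ φ}) : LinkPattern m :=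
  (φ.2.exists_represents h).choose

theorem linkPattern_represents (h : (blackTerms τ).card = 2 * m)
    (φ : {φ : Λ.Edge → Bool // Λ.IsFPLWith τ φ}) :
    (linkPattern h φ).Represents (Λ.term ∘ (blackTerms τ).orderEmbOfFin h) (pathSetoid φ.val) :=
  (φ.2.exists_represents h).choose_spec

theorem hasLinkPattern_iff (h : (blackTerms τ).card = 2 * m)
    (φ : {φ : Λ.Edge → Bool // Λ.IsFPLWith τ φ}) (π : LinkPattern m) :
    Λ.HasLinkPattern τ h φ.val π ↔ linkPattern h φ = π := by
  refine ⟨fun hπ => (linkPattern_represents h φ).unique (S := pathSetoid φ.val) hπ, ?_⟩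
  rintro rfl
  exact linkPattern_represents h φ

open Classical in
theorem refinedCount_eq_card (h : (blackTerms τ).card = 2 * m) (π : LinkPattern m) :
    Λ.refinedCount τ h π =
      ({φ | linkPattern h φ = π} : Finset {φ : Λ.Edge → Bool // Λ.IsFPLWith τ φ}).card := by
  rw [refinedCount, ← Fintype.card_subtype, ← Nat.card_eq_fintype_card]
  exact Nat.card_congr ((Equiv.subtypeSubtypeEquivSubtypeInter _ _).symm.trans
    (Equiv.subtypeEquivRight fun φ => hasLinkPattern_iff h φ π))

open Classical in
theorem state_eq_sum (h : (blackTerms τ).card = 2 * m) :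
    Λ.state τ h = ∑ φ : {φ : Λ.Edge → Bool // Λ.IsFPLWith τ φ},
      Finsupp.single (linkPattern h φ) (1 : ℂ) := by
  rw [state, ← Finset.sum_fiberwise (s := Finset.univ) (g := linkPattern h)]
  refine Finset.sum_congr rfl fun π _ => ?_
  rw [Finset.sum_congr rfl fun φ hφ => by rw [(Finset.mem_filter.1 hφ).2], Finset.sum_const,
    refinedCount_eq_card, Nat.cast_smul_eq_nsmul]

variable (Λ τ) in
open Classical in
theorem exists_closeProd_state (hn : (mixedPairs τ).card = 2 * n) :
    ∃ ρ : {φ : Λ.Edge → Bool // Λ.IsFPLWith τ φ} → LinkPattern n,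
      closeProd n (bbIndices τ) (Λ.state τ (card_blackTerms_eq τ hn)) =
        ∑ φ, Finsupp.single (ρ φ) 1 ∧
      ∀ φ, (ρ φ).Represents (Λ.term ∘ pairBlack τ ∘ (mixedPairs τ).orderEmbOfFin hn)
        (gluedPathSetoid τ φ.val) := by
  choose ρ hclose hρ using fun φ : {φ : Λ.Edge → Bool // Λ.IsFPLWith τ φ} =>
    (linkPattern_represents (card_blackTerms_eq τ hn) φ).exists_closeProd hn
  refine ⟨ρ, ?_, hρ⟩
  rw [state_eq_sum, map_sum]
  exact Finset.sum_congr rfl fun φ _ => hclose φ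

theorem IsFPLWith.represents_of_gyrate (hφ : Λ.IsFPLWith τ φ) (hvalid : Λ.ValidTriplet τ)
    (hn : (mixedPairs τ).card = 2 * n) {π : LinkPattern n}
    (hπ : π.Represents (Λ.term ∘ pairBlack (complBC τ) ∘
      (mixedPairs (complBC τ)).orderEmbOfFin ((mixedPairs_complBC τ).symm ▸ hn))
      (gluedPathSetoid (complBC τ) (gyrate φ))) :
    π.Represents (Λ.term ∘ pairBlack τ ∘ (mixedPairs τ).orderEmbOfFin hn)
      (gluedPathSetoid τ φ) := by
  simp only [mixedPairs_complBC] at hπ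
  exact fun i k => (hπ i k).trans <| and_congr_right' <| hφ.gluedPath_gyrate_iff hvalid
    (Finset.orderEmbOfFin_mem _ hn _) (Finset.orderEmbOfFin_mem _ hn _)

end LatticeDomain

theorem mainTheorem6 {N : ℕ} (Λ : LatticeDomain N) (τ : Fin (2 * N) → Bool)
    (hvalid : Λ.ValidTriplet τ) (n : ℕ) (hn : (mixedPairs τ).card = 2 * n) :
    closeProd n (bbIndices τ) (Λ.state τ (card_blackTerms_eq τ hn)) =
      closeProd n (bbIndices (complBC τ))
        (Λ.state (complBC τ)
          (card_blackTerms_eq (complBC τ) ((mixedPairs_complBC τ).symm ▸ hn))) := by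
  classical
  obtain ⟨ρ, hclose, hρ⟩ := LatticeDomain.exists_closeProd_state Λ τ hn
  obtain ⟨ρ', hclose', hρ'⟩ := LatticeDomain.exists_closeProd_state Λ (complBC τ)
    ((mixedPairs_complBC τ).symm ▸ hn)
  rw [hclose, hclose']
  refine Fintype.sum_equiv (Λ.gyrateEquiv τ) _ _ fun φ => ?_
  have hgyr := φ.2.represents_of_gyrate hvalid hn (hρ' (Λ.gyrateEquiv τ φ))
  rw [(hρ φ).unique hgyr]
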